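/- **Theorem 5.1.** For a finite metric space $(P,\mathsf d)$ and $\alpha\ge 1$, a directed graph $G=(P,E)$ is *$\alpha$-navigable* if for all $s,t\in P$ with $\mathsf d(s,t)>0$ there is $(s,u)\in E$ with $\mathsf d(u,t)<\mathsf d(s,t)/\alpha$. An $\alpha$-navigable graph $G$ is a *$c$-approximation to the sparsest $\alpha$-navigable graph* under the maximum out-degree objective (respectively, the number-of-edges objective) if its maximum out-degree (respectively, its number of edges) is at most $c$ times that of every $\alpha$-navigable graph on $P$. Let $\mathrm{OPT}_{\mathrm{size}}$ be the minimum number of edges of an $\alpha$-navigable graph on $P$. There are a single randomized algorithm and absolute constants $C_1,C_2,k$ such that for every $n\ge 2$, every $n$-point metric space $(P,\mathsf d)$ with points numbered $0,\dots,n-1$, and every real $\alpha\ge 1$, given $n$, $\alpha$ and query access to $\mathsf d$: * every run of the algorithm halts within $C_1\cdot n\cdot \mathrm{OPT}_{\mathrm{size}}\cdot(\ln n)^k=\tilde O(n\cdot \mathrm{OPT}_{\mathrm{size}})$ steps; * with probability at least $1-1/n$, the output is an $\alpha$-navigable graph on $P$ that is, simultaneously under both objectives, a $(C_2\ln n)$-approximation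 to the sparsest $\alpha$-navigable graph. Here an algorithm is a fixed program for a randomized word RAM with words of $O(\log n)$ bits. Its unit-time operations are arithmetic ($+,-,\times,\div,\bmod$), comparison, indirect memory access and control flow on words; drawing a uniformly random element of $\{0,\dots,m-1\}$ for a word $m \geq 1$; querying the distance between two points; dividing and comparing two real numbers that have been obtained (initially $\alpha$); and outputting an edge. -/

import Mathlib

namespace SparseNav

section Graphs

/-- A directed graph `G` on the points of a metric space is `α`-navigable if for all `s`, `t` with
`dist s t > 0` there is an edge `(s, u)` of `G` with `dist u t < dist s t / α`. -/
def Navigable {P : Type*} [MetricSpace P] (α : ℝ) (G : Digraph P) : Prop :=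
  ∀ s t : P, 0 < dist s t → ∃ u : P, G.Adj s u ∧ dist u t < dist s t / α

/-- The out-degree of a vertex. -/
noncomputable def outDegree {P : Type*} (G : Digraph P) (s : P) : ℕ :=
  {u : P | G.Adj s u}.ncard

/-- The maximum out-degree of a finite directed graph. -/
noncomputable def maxOutDegree {P : Type*} [Fintype P] (G : Digraph P) : ℕ :=
  Finset.univ.sup (outDegree G)

/-- The number of edges of a directed graph. -/
noncomputable def numEdges {P : Type*} (G : Digraph P) : ℕ :=
  {p : P × P | G.Adj p.1 p.2}.ncard

/-- `G` is a `c`-approximation to the sparsest `α`-navigable graph under the maximum out-degree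
objective. -/
def IsMaxDegApprox {P : Type*} [MetricSpace P] [Fintype P] (α c : ℝ) (G : Digraph P) : Prop :=
  Navigable α G ∧
    ∀ H : Digraph P, Navigable α H → (maxOutDegree G : ℝ) ≤ c * (maxOutDegree H : ℝ)

/-- `G` is a `c`-approximation to the sparsest `α`-navigable graph under the number-of-edges
(equivalently, average out-degree) objective. -/
def IsSizeApprox {P : Type*} [MetricSpace P] (α c : ℝ) (G : Digraph P) : Prop :=
  Navigable α G ∧
    ∀ H : Digraph P, Navigable α H → (numEdges G : ℝ) ≤ c * (numEdges H : ℝ)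

/-- The minimum number of edges of an `α`-navigable graph on `P`. -/
noncomputable def optSize (P : Type*) [MetricSpace P] (α : ℝ) : ℕ :=
  sInf {m : ℕ | ∃ G : Digraph P, Navigable α G ∧ numEdges G = m}

/-- For `α ≥ 1` the complete graph is navigable, so the minimum in `optSize` is over a nonempty
set and is attained. -/
theorem optSize_attained (P : Type*) [MetricSpace P] {α : ℝ} (hα : 1 ≤ α) :
    ∃ G : Digraph P, Navigable α G ∧ numEdges G = optSize P α := by
  have h : {m : ℕ | ∃ G : Digraph P, Navigable α G ∧ numEdges G = m}.Nonempty := by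
    refine ⟨_, ⟨fun _ _ => True⟩, fun s t hst => ⟨t, trivial, ?_⟩, rfl⟩
    rw [dist_self]
    positivity
  exact Nat.sInf_mem h

end Graphs

section Machine

/-! A randomized word RAM with access to a metric.  It has word registers and a random access
memory, both holding words, that is, integers in `[0, W)` with `W = 2 ^ b`, where `b` is the word
length; registers for real numbers, which can only be filled with a queried distance or with a
quotient of two real registers, and which can only be compared; and a write-only output
consisting of a list of edges.  A program is a fixed finite command.  Every single execution step
is a constant-time operation. -/

/-- Arithmetic operations on words (subtraction is truncated at `0`, division rounds down). -/
inductive ArithOp where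
  | add | sub | mul | div | mod

/-- The value of an arithmetic operation, before it is reduced modulo `W`. -/
def ArithOp.eval : ArithOp → ℕ → ℕ → ℕ
  | add, x, y => x + y
  | sub, x, y => x - y
  | mul, x, y => x * y
  | div, x, y => x / y
  | mod, x, y => x % y

/-- Programs.  Word registers, real registers and memory cells are indexed by natural numbers;
which registers an instruction refers to is fixed in the program, whereas the memory is addressed
by the content of a register. -/
inductive Cmd where
  /-- `reg[r] := c` -/
  | const (r c : ℕ)
  /-- `reg[r] := reg[a] op reg[b]` -/
  | arith (op : ArithOp) (r a b : ℕ)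
  /-- `reg[r] := mem[reg[a]]` -/
  | load (r a : ℕ)
  /-- `mem[reg[a]] := reg[b]` -/
  | store (a b : ℕ)
  /-- `reg[r] :=` a fresh uniformly random element of `{0, …, reg[a] - 1}` -/
  | rand (r a : ℕ)
  /-- `real[x] :=` the distance between the points number `reg[a]` and number `reg[b]` -/
  | query (x a b : ℕ)
  /-- `real[x] := real[y] / real[z]` -/
  | rdiv (x y z : ℕ)
  /-- `reg[r] := 1` if `real[x] < real[y]`, and `reg[r] := 0` otherwise -/
  | rlt (r x y : ℕ)
  /-- output the edge from point number `reg[a]` to point number `reg[b]` -/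
  | emit (a b : ℕ)
  /-- `c` and then `d` -/
  | seq (c d : Cmd)
  /-- if `reg[a] < reg[b]` then `c` else `d` -/
  | ite (a b : ℕ) (c d : Cmd)
  /-- while `reg[a] < reg[b]` do `c` -/
  | loop (a b : ℕ) (c : Cmd)

/-- The data a running program works on. -/
structure State where
  reg : ℕ → ℕ
  mem : ℕ → ℕ
  real : ℕ → ℝ
  out : List (ℕ × ℕ)

/-- Write the word `v mod W` into register `r`. -/
def State.setReg (W : ℕ) (s : State) (r v : ℕ) : State :=
  { s with reg := Function.update s.reg r (v % W) }

/-- A configuration: the commands that remain to be executed, first one first, and the data. -/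
abbrev Config := List Cmd × State

/-- The machine has halted when no command remains. -/
def Halted (c : Config) : Prop := c.1 = []

/-- The uniform distribution on `{0, …, v - 1}` (and the constant `0` if `v = 0`). -/
noncomputable def randBelow (v : ℕ) : PMF ℕ :=
  if h : v = 0 then PMF.pure 0
  else PMF.uniformOfFinset (Finset.range v) (Finset.nonempty_range_iff.mpr h)

open Classical in
/-- One step of the machine with words in `[0, W)` and distance oracle `D`.  A halted
configuration stays as it is. -/
noncomputable def step (W : ℕ) (D : ℕ → ℕ → ℝ) : Config → PMF Config
  | ([], s) => PMF.pure ([], s)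
  | (.const r c :: k, s) => PMF.pure (k, s.setReg W r c)
  | (.arith op r a b :: k, s) => PMF.pure (k, s.setReg W r (op.eval (s.reg a) (s.reg b)))
  | (.load r a :: k, s) => PMF.pure (k, s.setReg W r (s.mem (s.reg a)))
  | (.store a b :: k, s) =>
      PMF.pure (k, { s with mem := Function.update s.mem (s.reg a) (s.reg b) })
  | (.rand r a :: k, s) => (randBelow (s.reg a)).map fun v => (k, s.setReg W r v)
  | (.query x a b :: k, s) =>
      PMF.pure (k, { s with real := Function.update s.real x (D (s.reg a) (s.reg b)) })
  | (.rdiv x y z :: k, s) =>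
      PMF.pure (k, { s with real := Function.update s.real x (s.real y / s.real z) })
  | (.rlt r x y :: k, s) =>
      PMF.pure (k, s.setReg W r (if s.real x < s.real y then 1 else 0))
  | (.emit a b :: k, s) => PMF.pure (k, { s with out := (s.reg a, s.reg b) :: s.out })
  | (.seq c d :: k, s) => PMF.pure (c :: d :: k, s)
  | (.ite a b c d :: k, s) => PMF.pure (if s.reg a < s.reg b then c :: k else d :: k, s)
  | (.loop a b c :: k, s) =>
      PMF.pure (if s.reg a < s.reg b then c :: .loop a b c :: k else k, s)

/-- The distribution of the configuration after `T` steps from a given configuration. -/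
noncomputable def runFrom (W : ℕ) (D : ℕ → ℕ → ℝ) (c : Config) : ℕ → PMF Config
  | 0 => PMF.pure c
  | T + 1 => (runFrom W D c T).bind (step W D)

/-- The initial data: word register `0` holds the number `n` of points, real register `0` holds
the parameter `α`, everything else is zero and nothing has been output. -/
noncomputable def startState (W n : ℕ) (α : ℝ) : State where
  reg := Function.update (fun _ => 0) 0 (n % W)
  mem := fun _ => 0
  real := Function.update (fun _ => 0) 0 α
  out := []

/-- The distance oracle of a metric space whose points are numbered `0, …, n - 1`
(a query with an index that is out of range returns `0`). -/
noncomputable def oracle {P : Type*} [MetricSpace P] {n : ℕ} (e : Fin n ≃ P) (i j : ℕ) : ℝ :=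
  if h : i < n ∧ j < n then dist (e ⟨i, h.1⟩) (e ⟨j, h.2⟩) else 0

/-- The distribution of the configuration after `T` steps of the program `prog` with word length
`b`, on the metric space `P` with points numbered by `e`, and with parameter `α`. -/
noncomputable def run (prog : Cmd) (b : ℕ) {P : Type*} [MetricSpace P] {n : ℕ} (e : Fin n ≃ P)
    (α : ℝ) (T : ℕ) : PMF Config :=
  runFrom (2 ^ b) (oracle e) ([prog], startState (2 ^ b) n α) T

/-- The graph that has been output. -/
def outputGraph {P : Type*} {n : ℕ} (e : Fin n ≃ P) (c : Config) : Digraph P where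
  Adj u v := ((e.symm u : ℕ), (e.symm v : ℕ)) ∈ c.2.out

end Machine

end SparseNav

set_option linter.unusedSimpArgs false

namespace SparseNav

open scoped ENNReal

/-! ### Runs with a time budget and an error budget -/

section Budget

variable {W : ℕ} {D : ℕ → ℕ → ℝ} {G : State → Prop}

/-! Navigability decouples over sources. For a source `v`, the out-neighbours must cover every other
target, where `u` covers `t` if `covers D α v u t`. So the out-degree of `v` in any navigable graph
is at least the minimum cover size `K v = coverNumber D α n v` (`coverNumber_le_outDegree`), and it
suffices to output O(L · K v) edges at each `v`, with `L = n.size`. This bound at every vertex gives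
both approximations at once (`approx_of_outDegree_le`).

The cover is found by a greedy method with thresholds `τ = 2 ^ L, ..., 2, 1`. Counting what each
candidate covers exactly would be too slow, so counts are estimated from a sample of `256 * L * (|U|
/ τ)` uniform elements of the uncovered list `U`. In a phase, a candidate with at least `32 * L`
hits is taken, its targets are removed and the sample is redrawn. With good samples, every candidate
finally covers fewer than `τ` elements of `U`. For `τ = 1` this forces `U` to be empty, because
every target covers itself.

Time and number of edges must be bounded on every run, so they cannot rely on good samples. Two
checks secure them. A phase goes on only if no candidate has more than `1040 * L` hits; since `K`
points cover the sample, this certifies `|U| < 6 * K * τ` (`length_uncovered_lt`). A candidate found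
to cover fewer than `τ / 32` elements makes the source be given up, so a phase outputs at most `192
* K` edges. A failed check means a bad sample, so only the error probability pays for it. A phase
takes O(n L K) steps, and there are `L + 1` phases.

The program is verified by weakest preconditions carrying two budgets, time and error. A random draw
may distribute the error budget over its outcomes as long as the average does not grow
(`Cmd.wp_rand`). A sum of exponential moments, one for each undesired event, has exactly this
averaging property (`sum_potential`); it starts below `sampleError` and ends at 1 or more if an
event occurs. Hence the invariants of the form "good, or the budget has a surplus of 1": a surplus
excuses everything later.

Registers 0, 1, 2 hold `n`, 1, 0; 3 and 4 hold `L` and `2 ^ L`; 5 is the source, 6 is `|U|`, 7 is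
`τ`, 8 the candidate, 9 the sample size, 10 the hits; 20, 21, 22 hold `32 * L`, `1040 * L`, `256 *
L`. `U` is stored from cell 0 and the sample from cell `n`. Writing to register 19 serves as a
no-op. -/

theorem runFrom_succ (c : Config) (T : ℕ) :
    runFrom W D c (T + 1) = (step W D c).bind fun c' => runFrom W D c' T := by
  induction T with
  | zero => simp [runFrom]
  | succ T ih =>
    rw [runFrom, ih, PMF.bind_bind]
    rfl

/-- Every run from `c` halts within `T` steps, and the final data satisfy `G` except with
probability at most `ε`. -/
def Within (W : ℕ) (D : ℕ → ℕ → ℝ) (G : State → Prop) (c : Config) (T : ℕ) (ε : ℝ) : Prop :=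
  (∀ c' ∈ (runFrom W D c T).support, Halted c') ∧
    (runFrom W D c T).toOuterMeasure {c' | ¬ G c'.2} ≤ ENNReal.ofReal ε

theorem runFrom_nil (s : State) (T : ℕ) : runFrom W D ([], s) T = PMF.pure ([], s) := by
  induction T with
  | zero => rfl
  | succ T ih => simp [runFrom, ih, step]

theorem within_nil {s : State} {T : ℕ} {ε : ℝ} (h : G s ∨ 1 ≤ ε) : Within W D G ([], s) T ε := by
  classical
  refine ⟨fun c' hc' => ?_, ?_⟩
  · rw [runFrom_nil, PMF.support_pure] at hc'
    rw [Set.mem_singleton_iff.1 hc']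
    rfl
  · rw [runFrom_nil, PMF.toOuterMeasure_pure_apply]
    rcases h with h | h
    · simp [h]
    · refine le_trans ?_ (ENNReal.one_le_ofReal.2 h)
      split_ifs <;> simp

theorem Within.mono_error {c : Config} {T : ℕ} {ε ε' : ℝ} (h : Within W D G c T ε)
    (hε : ε ≤ ε') : Within W D G c T ε' :=
  ⟨h.1, h.2.trans (ENNReal.ofReal_le_ofReal hε)⟩

/-- All configurations in the support have halted, and `step` fixes these, so the distribution no
longer changes. -/
theorem Within.succ {c : Config} {T : ℕ} {ε : ℝ} (h : Within W D G c T ε) :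
    Within W D G c (T + 1) ε := by
  have key : runFrom W D c (T + 1) = runFrom W D c T := by
    change (runFrom W D c T).bind (step W D) = _
    conv_rhs => rw [← PMF.bind_pure (runFrom W D c T)]
    ext x
    rw [PMF.bind_apply, PMF.bind_apply]
    refine tsum_congr fun c' => ?_
    by_cases hc : c' ∈ (runFrom W D c T).support
    · obtain ⟨k, s⟩ := c'
      have : k = [] := h.1 _ hc
      subst this
      rfl
    · rw [PMF.mem_support_iff, not_not] at hc
      rw [hc, zero_mul, zero_mul]
  rw [Within, key]
  exact h

theorem Within.mono {c : Config} {T T' : ℕ} {ε ε' : ℝ} (h : Within W D G c T ε)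
    (hT : T ≤ T') (hε : ε ≤ ε') : Within W D G c T' ε' := by
  refine Within.mono_error ?_ hε
  induction hT with
  | refl => exact h
  | step _ ih => exact ih.succ

theorem within_of_step_eq {c c' : Config} {T : ℕ} {ε : ℝ} (hs : step W D c = PMF.pure c')
    (h : Within W D G c' T ε) : Within W D G c (T + 1) ε := by
  rw [Within, runFrom_succ, hs, PMF.pure_bind]
  exact h

theorem randBelow_apply {N v : ℕ} (hv : v < N) : randBelow N v = (N : ℝ≥0∞)⁻¹ := by
  have : N ≠ 0 := by omega
  simp [randBelow, this, PMF.uniformOfFinset_apply, hv]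

theorem randBelow_apply_of_le {N v : ℕ} (hN : 0 < N) (hv : N ≤ v) : randBelow N v = 0 := by
  have : N ≠ 0 := by omega
  simp [randBelow, this, PMF.uniformOfFinset_apply, hv]

/-- The failure probability is the average over the outcomes. A branch budget `f v` may exceed 1,
which concedes that branch altogether. -/
theorem within_rand {r a : ℕ} {k : List Cmd} {s : State} {T : ℕ} {ε : ℝ} (f : ℕ → ℝ)
    (hN : 0 < s.reg a) (hf : ∀ v < s.reg a, 0 ≤ f v)
    (hsum : ∑ v ∈ Finset.range (s.reg a), f v ≤ s.reg a * ε)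
    (h : ∀ v < s.reg a, Within W D G (k, s.setReg W r v) T (f v)) :
    Within W D G (.rand r a :: k, s) (T + 1) ε := by
  set N := s.reg a with hNdef
  have hrun : runFrom W D (.rand r a :: k, s) (T + 1) =
      (randBelow N).bind fun v => runFrom W D (k, s.setReg W r v) T := by
    rw [runFrom_succ, step, PMF.map, PMF.bind_bind]
    simp only [Function.comp, PMF.pure_bind]
    rfl
  refine ⟨fun c' hc' => ?_, ?_⟩
  · rw [hrun, PMF.mem_support_bind_iff] at hc'
    obtain ⟨v, hv, hc'⟩ := hc'
    refine (h v ?_).1 c' hc'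
    by_contra hlt
    exact hv (randBelow_apply_of_le hN (not_lt.1 hlt))
  · rw [hrun, PMF.toOuterMeasure_bind_apply, tsum_eq_sum (s := Finset.range N)]
    · calc _ ≤ ∑ v ∈ Finset.range N, (N : ℝ≥0∞)⁻¹ * ENNReal.ofReal (f v) := by
            refine Finset.sum_le_sum fun v hv => ?_
            have hv := Finset.mem_range.1 hv
            rw [randBelow_apply hv]
            gcongr
            exact (h v hv).2
        _ = (N : ℝ≥0∞)⁻¹ * ENNReal.ofReal (∑ v ∈ Finset.range N, f v) := by
            rw [← Finset.mul_sum, ENNReal.ofReal_sum_of_nonneg]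
            intro v hv
            exact hf v (Finset.mem_range.1 hv)
        _ ≤ (N : ℝ≥0∞)⁻¹ * ENNReal.ofReal (N * ε) := by gcongr
        _ = ENNReal.ofReal ε := by
            rw [ENNReal.ofReal_mul (by positivity), ENNReal.ofReal_natCast, ← mul_assoc,
              ENNReal.inv_mul_cancel (by simp; omega) (by simp), one_mul]
    · intro v hv
      rw [randBelow_apply_of_le hN (by simpa using hv), zero_mul]

end Budget

/-! ### Weakest preconditions -/

/-- An assertion about the data, the remaining time and the remaining error budget. -/
abbrev Assertion := State → ℕ → ℝ → Prop

/-- With time `T` and error budget `ε` left, executing `c` leads from `s` to data and budgets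
that satisfy `Post`. -/
def Cmd.wp (W : ℕ) (D : ℕ → ℕ → ℝ) (G : State → Prop) (c : Cmd) (Post : Assertion) : Assertion :=
  fun s T ε => ∀ k : List Cmd,
    (∀ s' T' ε', T' ≤ T → Post s' T' ε' → Within W D G (k, s') T' ε') →
      Within W D G (c :: k, s) T ε

/-- Execution of a command without loops and random draws. -/
noncomputable def Cmd.exec (W : ℕ) (D : ℕ → ℕ → ℝ) : Cmd → State → State
  | .const r c, s => s.setReg W r c
  | .arith op r a b, s => s.setReg W r (op.eval (s.reg a) (s.reg b))
  | .load r a, s => s.setReg W r (s.mem (s.reg a))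
  | .store a b, s => { s with mem := Function.update s.mem (s.reg a) (s.reg b) }
  | .query x a b, s => { s with real := Function.update s.real x (D (s.reg a) (s.reg b)) }
  | .rdiv x y z, s => { s with real := Function.update s.real x (s.real y / s.real z) }
  | .rlt r x y, s => open Classical in s.setReg W r (if s.real x < s.real y then 1 else 0)
  | .emit a b, s => { s with out := (s.reg a, s.reg b) :: s.out }
  | .seq c d, s => d.exec W D (c.exec W D s)
  | .ite a b c d, s => if s.reg a < s.reg b then c.exec W D s else d.exec W D s
  | .rand _ _, s => s
  | .loop _ _ _, s => s

/-- The command has neither loops nor random draws. -/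
def Cmd.straight : Cmd → Bool
  | .rand _ _ => false
  | .loop _ _ _ => false
  | .seq c d => c.straight && d.straight
  | .ite _ _ c d => c.straight && d.straight
  | _ => true

/-- An upper bound for the running time of a command without loops. -/
def Cmd.cost : Cmd → ℕ
  | .seq c d => c.cost + d.cost + 1
  | .ite _ _ c d => c.cost + d.cost + 1
  | _ => 1

/-! ### Proof rules for the commands -/

section Rules

variable {W : ℕ} {D : ℕ → ℕ → ℝ} {G : State → Prop} {Post : Assertion} {s : State} {T : ℕ} {ε : ℝ}

theorem Cmd.wp_mono {c : Cmd} {Post' : Assertion} {T₀ : ℕ} {ε₀ : ℝ} (hT : T₀ ≤ T) (hε : ε₀ ≤ ε)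
    (hP : ∀ s' T' ε', T' ≤ T₀ → Post' s' T' ε' → Post s' T' ε') (h : c.wp W D G Post' s T₀ ε₀) :
    c.wp W D G Post s T ε :=
  fun k hk => (h k fun s' T' ε' hT' hp => hk s' T' ε' (hT'.trans hT) (hP s' T' ε' hT' hp)).mono
    hT hε

theorem Cmd.wp_seq {c d : Cmd} (hT : 1 ≤ T)
    (h : c.wp W D G (d.wp W D G Post) s (T - 1) ε) : (Cmd.seq c d).wp W D G Post s T ε := by
  obtain ⟨T, rfl⟩ := Nat.exists_eq_add_of_le' hT
  rw [Nat.add_sub_cancel] at h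
  intro k hk
  refine within_of_step_eq rfl (h (d :: k) fun s' T' ε' hT' hp => ?_)
  exact hp k fun s'' T'' ε'' hT'' hp' => hk s'' T'' ε'' (by omega) hp'

theorem Cmd.wp_ite {a b : ℕ} {c d : Cmd} (hT : 1 ≤ T)
    (h₁ : s.reg a < s.reg b → c.wp W D G Post s (T - 1) ε)
    (h₂ : s.reg b ≤ s.reg a → d.wp W D G Post s (T - 1) ε) :
    (Cmd.ite a b c d).wp W D G Post s T ε := by
  obtain ⟨T, rfl⟩ := Nat.exists_eq_add_of_le' hT
  rw [Nat.add_sub_cancel] at h₁ h₂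
  intro k hk
  refine within_of_step_eq rfl ?_
  have hk' : ∀ s' T' ε', T' ≤ T → Post s' T' ε' → Within W D G (k, s') T' ε' :=
    fun s' T' ε' hT' hp => hk s' T' ε' (by omega) hp
  split_ifs with hab
  · exact h₁ hab k hk'
  · exact h₂ (not_lt.1 hab) k hk'

/-- No separate termination measure is needed: each loop test consumes a step and the invariant must
guarantee that a step is left, so the time budget itself is the variant. -/
theorem Cmd.wp_loop {a b : ℕ} {c : Cmd} (Inv : Assertion) (h : Inv s T ε)
    (hstep : ∀ s T ε, Inv s T ε → 1 ≤ T ∧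
      (s.reg a < s.reg b → c.wp W D G Inv s (T - 1) ε) ∧
      (s.reg b ≤ s.reg a → Post s (T - 1) ε)) :
    (Cmd.loop a b c).wp W D G Post s T ε := by
  intro k hk
  induction T using Nat.strong_induction_on generalizing s ε with
  | _ T ih =>
    obtain ⟨hT, h₁, h₂⟩ := hstep s T ε h
    obtain ⟨T, rfl⟩ := Nat.exists_eq_add_of_le' hT
    rw [Nat.add_sub_cancel] at h₁ h₂
    refine within_of_step_eq rfl ?_
    split_ifs with hab
    · refine h₁ hab _ fun s' T' ε' hT' hI => ih T' (by omega) hI fun s'' T'' ε'' hT'' hp => ?_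
      exact hk s'' T'' ε'' (by omega) hp
    · exact hk s T ε (by omega) (h₂ (not_lt.1 hab))

theorem Cmd.wp_rand {r a : ℕ} (f : ℕ → ℝ) (hT : 1 ≤ T) (hN : 0 < s.reg a)
    (hf : ∀ v < s.reg a, 0 ≤ f v)
    (hsum : ∑ v ∈ Finset.range (s.reg a), f v ≤ s.reg a * ε)
    (h : ∀ v < s.reg a, Post (s.setReg W r v) (T - 1) (f v)) :
    (Cmd.rand r a).wp W D G Post s T ε := by
  obtain ⟨T, rfl⟩ := Nat.exists_eq_add_of_le' hT
  rw [Nat.add_sub_cancel] at h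
  intro k hk
  exact within_rand f hN hf hsum fun v hv => hk _ _ _ (by omega) (h v hv)

theorem within_exec {c : Cmd} (hc : c.straight) {k : List Cmd} {s : State} {T : ℕ}
    (h : Within W D G (k, c.exec W D s) T ε) : Within W D G (c :: k, s) (T + c.cost) ε := by
  induction c generalizing k s T with
  | rand | loop => simp [Cmd.straight] at hc
  | seq c d ihc ihd =>
    simp only [Cmd.straight, Bool.and_eq_true] at hc
    have : T + (Cmd.seq c d).cost = (T + d.cost + c.cost) + 1 := by simp only [Cmd.cost]; omega
    rw [this]
    exact within_of_step_eq rfl (ihc hc.1 (ihd hc.2 h))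
  | ite a b c d ihc ihd =>
    simp only [Cmd.straight, Bool.and_eq_true] at hc
    have : T + (Cmd.ite a b c d).cost = (T + (c.cost + d.cost)) + 1 := rfl
    rw [this]
    refine within_of_step_eq rfl ?_
    rw [Cmd.exec] at h
    split_ifs with hab
    · rw [if_pos hab] at h
      -- The cost of a conditional charges both branches; the unused part is dropped by
      -- monotonicity.
      exact (ihc hc.1 h).mono (by omega) le_rfl
    · rw [if_neg hab] at h
      exact (ihd hc.2 h).mono (by omega) le_rfl
  | _ => exact within_of_step_eq rfl h

theorem Cmd.wp_exec {c : Cmd} (hc : c.straight) (hT : c.cost ≤ T)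
    (h : Post (c.exec W D s) (T - c.cost) ε) : c.wp W D G Post s T ε := by
  intro k hk
  have := within_exec hc (hk _ _ _ (by omega) h)
  rwa [Nat.sub_add_cancel hT] at this

end Rules

/-! ### The program -/

/-- Sequential composition of a list of commands. -/
def Cmd.block : List Cmd → Cmd
  | [] => .const 19 0
  | [c] => c
  | c :: cs => .seq c (Cmd.block cs)

/-- `reg[14] := 1` if point `reg[8]` covers point `reg[13]` with respect to the source `reg[5]`. -/
def testCmd : Cmd :=
  .block [.query 1 5 13, .rdiv 1 1 0, .query 2 8 13, .rlt 14 2 1]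

/-- One step of the scan of the sample. -/
def hitsBody : Cmd :=
  .block [.arith .add 15 0 11, .load 13 15, testCmd, .arith .add 10 10 14, .arith .add 11 11 1]

/-- `reg[10] :=` the number of sample elements that are covered by point `reg[8]`. -/
def hitsCmd : Cmd :=
  .block [.const 10 0, .const 11 0, .loop 11 9 hitsBody]

/-- One random draw. -/
def drawTail : Cmd :=
  .block [.load 13 16, .arith .add 15 0 11, .store 15 13, .arith .add 11 11 1]

/-- Fill the sample with random uncovered points. -/
def drawCmd : Cmd :=
  .seq (.block [.arith .div 16 6 7, .arith .mul 9 22 16, .const 11 0])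
    (.loop 11 9 (.seq (.rand 16 6) drawTail))

/-- One step of the removal of covered points. -/
def filterBody : Cmd :=
  .block [.load 13 11, testCmd, .ite 14 1 (.seq (.store 12 13) (.arith .add 12 12 1)) (.const 19 0),
    .arith .add 11 11 1]

/-- Remove the points covered by `reg[8]` from the list of uncovered points. -/
def filterCmd : Cmd :=
  .block [.emit 5 8, .const 11 0, .const 12 0, .loop 11 6 filterBody]

/-- Add the edge from `reg[5]` to `reg[8]`; give up if it turns out to cover too few new points. -/
def takeCmd : Cmd :=
  .seq filterCmd (.seq
    (.block [.arith .sub 16 6 12, .arith .add 6 12 2, .const 17 32, .arith .mul 16 16 17])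
    (.ite 16 7 (.seq (.const 7 0) (.arith .add 8 0 2)) drawCmd))

/-- Test whether point `reg[8]` seems to cover too many points. -/
def certBody : Cmd :=
  .seq hitsCmd (.seq (.ite 21 10 (.const 7 0) (.const 19 0)) (.arith .add 8 8 1))

/-- Take point `reg[8]` if it seems to cover many points. -/
def passBody : Cmd :=
  .seq hitsCmd (.seq (.ite 10 20 (.const 19 0) takeCmd) (.arith .add 8 8 1))

/-- A phase with threshold `reg[7]`. -/
def phaseCmd : Cmd :=
  .seq drawCmd (.seq (.const 8 0) (.seq (.loop 8 0 certBody) (.seq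
    (.ite 2 7 (.const 8 0) (.const 19 0)) (.seq (.loop 8 0 passBody)
      (.block [.const 17 2, .arith .div 7 7 17])))))

/-- One step of the initialization of the list of uncovered points. -/
def initBody : Cmd :=
  .seq (.ite 11 5 (.seq (.store 6 11) (.arith .add 6 6 1))
    (.ite 5 11 (.seq (.store 6 11) (.arith .add 6 6 1)) (.const 19 0))) (.arith .add 11 11 1)

/-- Output the out-edges of the source `reg[5]`. -/
def sourceCmd : Cmd :=
  .seq (.block [.const 6 0, .const 11 0, .loop 11 0 initBody])
    (.seq (.arith .add 7 4 2) (.loop 2 7 phaseCmd))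

/-- The whole program. -/
def navCmd : Cmd :=
  .seq (.block [.const 1 1, .const 4 1, .arith .add 16 0 1]) (.seq
    (.loop 4 16 (.seq (.arith .add 4 4 4) (.arith .add 3 3 1))) (.seq
      (.block [.const 17 256, .arith .mul 22 17 3, .const 17 32, .arith .mul 20 17 3,
        .const 17 1040, .arith .mul 21 17 3, .const 5 0])
      (.loop 5 0 (.seq sourceCmd (.arith .add 5 5 1)))))

/-! ### Deterministic subroutines -/

/-- Point `u` is closer to `t` than `s` is, by more than the factor `α`. -/
noncomputable def covers (D : ℕ → ℕ → ℝ) (α : ℝ) (s u t : ℕ) : Bool :=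
  open Classical in decide (D u t < D s t / α)

/-- At most the word registers in `F` have changed, and the parameter is still there. -/
def Frame (F : List ℕ) (s s' : State) : Prop :=
  (∀ r, r ∉ F → s'.reg r = s.reg r) ∧ s'.real 0 = s.real 0

/-- The memory cells from `a` on contain the list `l`. -/
def Stores (mem : ℕ → ℕ) (a : ℕ) (l : List ℕ) : Prop :=
  ∀ i (hi : i < l.length), mem (a + i) = l[i]

theorem Frame.refl (F : List ℕ) (s : State) : Frame F s s := ⟨fun _ _ => rfl, rfl⟩

theorem Frame.trans {F F' F'' : List ℕ} {s s' s'' : State} (h : Frame F s s')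
    (h' : Frame F' s' s'') (hF : F ⊆ F'' := by decide) (hF' : F' ⊆ F'' := by decide) :
    Frame F'' s s'' :=
  ⟨fun r hr => (h'.1 r fun hr' => hr (hF' hr')).trans (h.1 r fun hr' => hr (hF hr')),
    h'.2.trans h.2⟩

@[simp] theorem State.setReg_reg (W : ℕ) (s : State) (r v r' : ℕ) :
    (s.setReg W r v).reg r' = if r' = r then v % W else s.reg r' := by
  simp [State.setReg, Function.update_apply]

@[simp] theorem State.setReg_mem (W : ℕ) (s : State) (r v : ℕ) :
    (s.setReg W r v).mem = s.mem := rfl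

@[simp] theorem State.setReg_real (W : ℕ) (s : State) (r v : ℕ) :
    (s.setReg W r v).real = s.real := rfl

@[simp] theorem State.setReg_out (W : ℕ) (s : State) (r v : ℕ) :
    (s.setReg W r v).out = s.out := rfl

section

variable {W : ℕ} {D : ℕ → ℕ → ℝ} {G : State → Prop} {Post : Assertion} {s : State} {T : ℕ} {ε : ℝ}
variable {n : ℕ} {α : ℝ}

@[simp] theorem exec_testCmd_reg (s : State) (r : ℕ) :
    (testCmd.exec W D s).reg r = if r = 14 then
      (if covers D (s.real 0) (s.reg 5) (s.reg 8) (s.reg 13) then 1 else 0) % W else s.reg r := by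
  simp [testCmd, Cmd.block, Cmd.exec, covers]

@[simp] theorem exec_testCmd_mem (s : State) : (testCmd.exec W D s).mem = s.mem := rfl

@[simp] theorem exec_testCmd_out (s : State) : (testCmd.exec W D s).out = s.out := rfl

@[simp] theorem exec_testCmd_real (s : State) : (testCmd.exec W D s).real 0 = s.real 0 := by
  simp [testCmd, Cmd.block, Cmd.exec]

theorem countP_take_succ {β : Type*} (p : β → Bool) (l : List β) {i : ℕ} (hi : i < l.length) :
    (l.take (i + 1)).countP p = (l.take i).countP p + if p l[i] then 1 else 0 := by
  rw [List.take_succ_eq_append_getElem hi, List.countP_append, List.countP_singleton]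

/-- An iteration costs 16 steps: 15 for `hitsBody` and one for the loop test. The coefficients in
the other loops arise in the same way. -/
theorem wp_hitsCmd {ρ : List ℕ} (hT : 16 * ρ.length + 5 ≤ T) (h0 : s.reg 0 = n) (h1 : s.reg 1 = 1)
    (h9 : s.reg 9 = ρ.length) (hW : n + ρ.length < W)
    (hmem : Stores s.mem n ρ) (hρ : ∀ t ∈ ρ, t < W)
    (h : ∀ s', Frame [10, 11, 13, 14, 15] s s' → s'.mem = s.mem → s'.out = s.out →
      s'.reg 10 = ρ.countP (covers D (s.real 0) (s.reg 5) (s.reg 8)) →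
      Post s' (T - (16 * ρ.length + 5)) ε) :
    hitsCmd.wp W D G Post s T ε := by
  refine Cmd.wp_seq (by omega) (Cmd.wp_exec rfl (by simp [Cmd.cost]; omega) ?_)
  refine Cmd.wp_seq (by simp [Cmd.cost]; omega)
    (Cmd.wp_exec rfl (by simp [Cmd.cost]; omega) ?_)
  refine Cmd.wp_loop (fun s' T' ε' => ∃ i ≤ ρ.length, Frame [10, 11, 13, 14, 15] s s' ∧
    s'.mem = s.mem ∧ s'.out = s.out ∧ s'.reg 11 = i ∧
    s'.reg 10 = (ρ.take i).countP (covers D (s.real 0) (s.reg 5) (s.reg 8)) ∧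
    T' = 16 * (ρ.length - i) + 1 + (T - (16 * ρ.length + 5)) ∧ ε' = ε) ?_ ?_
  · refine ⟨0, by omega, ⟨?_, rfl⟩, rfl, rfl, ?_, ?_, ?_, rfl⟩
    · intro r hr
      simp at hr
      simp [Cmd.exec, hr]
    · simp [Cmd.exec]
    · simp [Cmd.exec]
    · simp [Cmd.cost]; omega
  · rintro s' T' ε' ⟨i, hi, hF, hm, ho, h11, h10, rfl, rfl⟩
    have e9 := hF.1 9 (by decide)
    have e0 := hF.1 0 (by decide)
    have e1 := hF.1 1 (by decide)
    have e5 := hF.1 5 (by decide)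
    have e8 := hF.1 8 (by decide)
    refine ⟨by omega, fun hlt => ?_, fun hle => ?_⟩
    · have hi' : i < ρ.length := by omega
      refine Cmd.wp_exec rfl (by simp [hitsBody, testCmd, Cmd.block, Cmd.cost]; omega) ?_
      have ht := hρ _ (List.getElem_mem hi')
      have hc : (ρ.take i).countP (covers D (s.real 0) (s.reg 5) (s.reg 8)) ≤ i :=
        (List.countP_le_length).trans (by simp)
      have a0 : (n + i) % W = n + i := Nat.mod_eq_of_lt (by omega)
      have a1 : (i + 1) % W = i + 1 := Nat.mod_eq_of_lt (by omega)
      have a2 : ρ[i] % W = ρ[i] := Nat.mod_eq_of_lt ht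
      refine ⟨i + 1, hi', ⟨fun r hr => ?_, ?_⟩, ?_, ?_, ?_, ?_, ?_, rfl⟩
      · simp at hr
        simp [hitsBody, Cmd.block, Cmd.exec, hr, ← hF.1 r (by simp [hr])]
      · simp [hitsBody, Cmd.block, Cmd.exec, hF.2]
      · simp [hitsBody, Cmd.block, Cmd.exec, hm]
      · simp [hitsBody, Cmd.block, Cmd.exec, ho]
      · simp [hitsBody, Cmd.block, Cmd.exec, e1, h1, h11, ArithOp.eval, a1]
      · simp [hitsBody, Cmd.block, Cmd.exec, ArithOp.eval, h10, e0, h0, h11, e5, e8, hF.2,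
          hm, a0, a2, hmem i hi', countP_take_succ _ _ hi']
        refine Nat.mod_eq_of_lt ?_
        split_ifs <;> omega
      · simp [hitsBody, testCmd, Cmd.block, Cmd.cost]; omega
    · have : i = ρ.length := by omega
      subst this
      have := h s' hF hm ho (by rw [h10, List.take_length])
      convert this using 1
      omega

/-- The list is compacted in place. The write index never overtakes the read index, so the cells not
yet read are intact; the invariant records this separately from the part already filtered. -/
theorem wp_filterCmd {l : List ℕ} (hT : 18 * l.length + 7 ≤ T) (h1 : s.reg 1 = 1)
    (h6 : s.reg 6 = l.length) (hW : l.length < W) (hW1 : 1 < W)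
    (hmem : Stores s.mem 0 l) (hl : ∀ t ∈ l, t < W)
    (h : ∀ s', Frame [11, 12, 13, 14, 19] s s' →
      Stores s'.mem 0 (l.filter fun t => !covers D (s.real 0) (s.reg 5) (s.reg 8) t) →
      s'.out = (s.reg 5, s.reg 8) :: s.out →
      s'.reg 12 = (l.filter fun t => !covers D (s.real 0) (s.reg 5) (s.reg 8) t).length →
      Post s' (T - (18 * l.length + 7)) ε) :
    filterCmd.wp W D G Post s T ε := by
  set p : ℕ → Bool := fun t => !covers D (s.real 0) (s.reg 5) (s.reg 8) t with hp
  refine Cmd.wp_seq (by omega) (Cmd.wp_exec rfl (by simp [Cmd.cost]; omega) ?_)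
  refine Cmd.wp_seq (by simp [Cmd.cost]; omega)
    (Cmd.wp_exec rfl (by simp [Cmd.cost]; omega) ?_)
  refine Cmd.wp_seq (by simp [Cmd.cost]; omega)
    (Cmd.wp_exec rfl (by simp [Cmd.cost]; omega) ?_)
  refine Cmd.wp_loop (fun s' T' ε' => ∃ i ≤ l.length, Frame [11, 12, 13, 14, 19] s s' ∧
    Stores s'.mem 0 ((l.take i).filter p) ∧
    (∀ j (hj : j < l.length), i ≤ j → s'.mem j = l[j]) ∧
    s'.out = (s.reg 5, s.reg 8) :: s.out ∧ s'.reg 11 = i ∧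
    s'.reg 12 = ((l.take i).filter p).length ∧
    T' = 18 * (l.length - i) + 1 + (T - (18 * l.length + 7)) ∧ ε' = ε) ?_ ?_
  · refine ⟨0, by omega, ⟨?_, rfl⟩, ?_, ?_, rfl, ?_, ?_, ?_, rfl⟩
    · intro r hr
      simp at hr
      simp [Cmd.exec, hr]
    · intro i hi
      simp at hi
    · intro j hj _
      have := hmem j hj
      rw [Nat.zero_add] at this
      exact this
    · simp [Cmd.exec]
    · simp [Cmd.exec]
    · simp [Cmd.cost]; omega
  · rintro s' T' ε' ⟨i, hi, hF, hm, hm', ho, h11, h12, rfl, rfl⟩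
    have e6 := hF.1 6 (by decide)
    have e1 := hF.1 1 (by decide)
    have e5 := hF.1 5 (by decide)
    have e8 := hF.1 8 (by decide)
    refine ⟨by omega, fun hlt => ?_, fun hle => ?_⟩
    · have hi' : i < l.length := by omega
      refine Cmd.wp_exec rfl (by simp [filterBody, testCmd, Cmd.block, Cmd.cost]; omega) ?_
      have ht := hl _ (List.getElem_mem hi')
      have hc : ((l.take i).filter p).length ≤ i :=
        (List.length_filter_le _ _).trans (by simp)
      have a1 : (i + 1) % W = i + 1 := Nat.mod_eq_of_lt (by omega)
      have a2 : l[i] % W = l[i] := Nat.mod_eq_of_lt ht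
      have a3 : 1 % W = 1 := Nat.mod_eq_of_lt hW1
      have a4 : (((l.take i).filter p).length + 1) % W = ((l.take i).filter p).length + 1 :=
        Nat.mod_eq_of_lt (by omega)
      have hi0 := hm' i hi' le_rfl
      by_cases hcov : covers D (s.real 0) (s.reg 5) (s.reg 8) l[i]
      · have hnext : (l.take (i + 1)).filter p = (l.take i).filter p := by
          rw [List.take_succ_eq_append_getElem hi', List.filter_append]
          simp [hp, hcov]
        refine ⟨i + 1, hi', ⟨fun r hr => ?_, ?_⟩, ?_, ?_, ?_, ?_, ?_, ?_, rfl⟩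
        · simp at hr
          simp [filterBody, Cmd.block, Cmd.exec, h11, hi0, a2, a3, e5, e8, hF.2, hcov, h1, e1, hr,
            ← hF.1 r (by simp [hr])]
        · simp [filterBody, Cmd.block, Cmd.exec, h11, hi0, a2, a3, e5, e8, hF.2, hcov, h1, e1]
        · rw [hnext]
          simpa [filterBody, Cmd.block, Cmd.exec, h11, hi0, a2, a3, e5, e8, hF.2, hcov, h1, e1]
            using hm
        · intro j hj hij
          simpa [filterBody, Cmd.block, Cmd.exec, h11, hi0, a2, a3, e5, e8, hF.2, hcov, h1, e1]
            using hm' j hj (by omega)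
        · simp [filterBody, Cmd.block, Cmd.exec, h11, hi0, a2, a3, e5, e8, hF.2, hcov, h1, e1, ho]
        · simp [filterBody, Cmd.block, Cmd.exec, h11, hi0, a2, a3, e5, e8, hF.2, hcov, h1, e1, a1,
            ArithOp.eval]
        · rw [hnext]
          simp [filterBody, Cmd.block, Cmd.exec, h11, hi0, a2, a3, e5, e8, hF.2, hcov, h1, e1, h12]
        · simp [filterBody, testCmd, Cmd.block, Cmd.cost]; omega
      · have hnext : (l.take (i + 1)).filter p = (l.take i).filter p ++ [l[i]] := by
          rw [List.take_succ_eq_append_getElem hi', List.filter_append]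
          simp [hp, hcov]
        refine ⟨i + 1, hi', ⟨fun r hr => ?_, ?_⟩, ?_, ?_, ?_, ?_, ?_, ?_, rfl⟩
        · simp at hr
          simp [filterBody, Cmd.block, Cmd.exec, h11, hi0, a2, a3, e5, e8, hF.2, hcov, h1, e1, hr,
            ← hF.1 r (by simp [hr])]
        · simp [filterBody, Cmd.block, Cmd.exec, h11, hi0, a2, a3, e5, e8, hF.2, hcov, h1, e1]
        · rw [hnext]
          intro j hj
          rw [List.length_append, List.length_singleton] at hj
          simp [filterBody, Cmd.block, Cmd.exec, h11, hi0, a2, a3, e5, e8, hF.2, hcov, h1, e1, h12,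
            Function.update_apply]
          rcases Nat.lt_or_ge j ((l.take i).filter p).length with hj' | hj'
          · rw [if_neg (by omega), List.getElem_append_left hj']
            simpa using hm j hj'
          · have : j = ((l.take i).filter p).length := by omega
            subst this
            simp
        · intro j hj hij
          have := hm' j hj (by omega)
          simp [filterBody, Cmd.block, Cmd.exec, h11, hi0, a2, a3, e5, e8, hF.2, hcov, h1, e1, h12,
            Function.update_apply]
          rw [if_neg (by omega), this]
        · simp [filterBody, Cmd.block, Cmd.exec, h11, hi0, a2, a3, e5, e8, hF.2, hcov, h1, e1, ho]
        · simp [filterBody, Cmd.block, Cmd.exec, h11, hi0, a2, a3, e5, e8, hF.2, hcov, h1, e1, a1,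
            ArithOp.eval]
        · rw [hnext, List.length_append, List.length_singleton]
          simp [filterBody, Cmd.block, Cmd.exec, h11, hi0, a2, a3, e5, e8, hF.2, hcov, h1, e1, h12,
            ArithOp.eval, a4]
        · simp [filterBody, testCmd, Cmd.block, Cmd.cost]; omega
    · have : i = l.length := by omega
      subst this
      rw [List.take_length] at hm h12
      have := h s' hF hm ho h12
      convert this using 1
      omega

theorem wp_initLoop (hT : 12 * n + 5 ≤ T) (h0 : s.reg 0 = n) (h1 : s.reg 1 = 1)
    (hW : n < W)
    (h : ∀ s', Frame [6, 11, 19] s s' →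
      Stores s'.mem 0 ((List.range n).filter fun t => t ≠ s.reg 5) → s'.out = s.out →
      s'.reg 6 = ((List.range n).filter fun t => t ≠ s.reg 5).length →
      Post s' (T - (12 * n + 5)) ε) :
    (Cmd.block [.const 6 0, .const 11 0, .loop 11 0 initBody]).wp W D G Post s T ε := by
  refine Cmd.wp_seq (by omega) (Cmd.wp_exec rfl (by simp [Cmd.cost]; omega) ?_)
  refine Cmd.wp_seq (by simp [Cmd.cost]; omega)
    (Cmd.wp_exec rfl (by simp [Cmd.cost]; omega) ?_)
  refine Cmd.wp_loop (fun s' T' ε' => ∃ i ≤ n, Frame [6, 11, 19] s s' ∧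
    Stores s'.mem 0 ((List.range i).filter fun t => t ≠ s.reg 5) ∧
    s'.out = s.out ∧ s'.reg 11 = i ∧
    s'.reg 6 = ((List.range i).filter fun t => t ≠ s.reg 5).length ∧
    T' = 12 * (n - i) + 1 + (T - (12 * n + 5)) ∧ ε' = ε) ?_ ?_
  · refine ⟨0, by omega, ⟨?_, rfl⟩, ?_, rfl, ?_, ?_, ?_, rfl⟩
    · intro r hr
      simp at hr
      simp [Cmd.exec, hr]
    · intro i hi
      simp at hi
    · simp [Cmd.exec]
    · simp [Cmd.exec]
    · simp [Cmd.cost]; omega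
  · rintro s' T' ε' ⟨i, hi, hF, hm, ho, h11, h6, rfl, rfl⟩
    have e0 := hF.1 0 (by decide)
    have e1 := hF.1 1 (by decide)
    have e5 := hF.1 5 (by decide)
    refine ⟨by omega, fun hlt => ?_, fun hle => ?_⟩
    · have hi' : i < n := by omega
      refine Cmd.wp_exec rfl (by simp [initBody, Cmd.cost]; omega) ?_
      have hc : ((List.range i).filter fun t => t ≠ s.reg 5).length ≤ i :=
        (List.length_filter_le _ _).trans (by simp)
      have a1 : (i + 1) % W = i + 1 := Nat.mod_eq_of_lt (by omega)
      have a4 : (((List.range i).filter fun t => t ≠ s.reg 5).length + 1) % W =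
        ((List.range i).filter fun t => t ≠ s.reg 5).length + 1 := Nat.mod_eq_of_lt (by omega)
      by_cases heq : i = s.reg 5
      · have hnext : ((List.range (i + 1)).filter fun t => t ≠ s.reg 5) =
            (List.range i).filter fun t => t ≠ s.reg 5 := by
          rw [List.range_succ, List.filter_append]
          simp [heq]
        have n1 : ¬ s'.reg 11 < s'.reg 5 := by omega
        have n2 : ¬ s'.reg 5 < s'.reg 11 := by omega
        refine ⟨i + 1, hi', ⟨fun r hr => ?_, ?_⟩, ?_, ?_, ?_, ?_, ?_, rfl⟩
        · simp at hr
          simp [initBody, Cmd.exec, n1, n2, hr, ← hF.1 r (by simp [hr])]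
        · simp [initBody, Cmd.exec, n1, n2, hF.2]
        · rw [hnext]
          simpa [initBody, Cmd.exec, n1, n2] using hm
        · simp [initBody, Cmd.exec, n1, n2, ho]
        · simp only [initBody, Cmd.exec, if_neg n1, if_neg n2]
          simp [ArithOp.eval, h11, e1, h1, a1]
        · rw [hnext]
          simp [initBody, Cmd.exec, n1, n2, h6]
        · simp [initBody, Cmd.cost]; omega
      · have hnext : ((List.range (i + 1)).filter fun t => t ≠ s.reg 5) =
            ((List.range i).filter fun t => t ≠ s.reg 5) ++ [i] := by
          rw [List.range_succ, List.filter_append]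
          simp [heq]
        -- The machine can only test `<`, so inequality of two words is tested in both orders; the
        -- two branches execute the same commands.
        have hbranch : initBody.exec W D s' = (Cmd.arith .add 11 11 1).exec W D
            ((Cmd.seq (.store 6 11) (.arith .add 6 6 1)).exec W D s') := by
          rcases lt_or_gt_of_ne heq with hlt | hgt
          · have n1 : s'.reg 11 < s'.reg 5 := by omega
            simp only [initBody, Cmd.exec, if_pos n1]
          · have n1 : ¬ s'.reg 11 < s'.reg 5 := by omega
            have n2 : s'.reg 5 < s'.reg 11 := by omega
            simp only [initBody, Cmd.exec, if_neg n1, if_pos n2]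
        rw [hbranch]
        refine ⟨i + 1, hi', ⟨fun r hr => ?_, ?_⟩, ?_, ?_, ?_, ?_, ?_, rfl⟩
        · simp at hr
          simp [Cmd.exec, hr, ← hF.1 r (by simp [hr])]
        · simp [Cmd.exec, hF.2]
        · rw [hnext]
          intro j hj
          rw [List.length_append, List.length_singleton] at hj
          simp only [Cmd.exec, State.setReg_mem, Function.update_apply, h6, h11, Nat.zero_add]
          rcases Nat.lt_or_ge j ((List.range i).filter fun t => t ≠ s.reg 5).length with hj' | hj'
          · rw [if_neg (by omega), List.getElem_append_left hj']
            simpa using hm j hj'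
          · have : j = ((List.range i).filter fun t => t ≠ s.reg 5).length := by omega
            subst this
            simp
        · simp [Cmd.exec, ho]
        · simp [Cmd.exec, ArithOp.eval, h11, e1, h1, a1]
        · rw [hnext, List.length_append, List.length_singleton, ← a4]
          simp [Cmd.exec, ArithOp.eval, h6, e1, h1]
        · simp [initBody, Cmd.cost]; omega
    · have : i = n := by omega
      subst this
      have := h s' hF hm ho h6
      convert this using 1
      omega

end

/-! ### Random sampling with an exponential potential -/

/-- A weight `a * g ^ k * x ^ h`, where `h` counts the elements that satisfy `p` in the sample drawn
so far and `k` is the number of missing draws. -/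
structure Test where
  p : ℕ → Bool
  a : ℝ
  g : ℝ
  x : ℝ

/-- The weight of a partial sample. -/
noncomputable def Test.weight (c : Test) (k : ℕ) (ρ : List ℕ) : ℝ :=
  c.a * c.g ^ k * c.x ^ ρ.countP c.p

/-- The weight is a martingale when elements of `l` are drawn. -/
structure Test.Fair (c : Test) (l : List ℕ) : Prop where
  a_nonneg : 0 ≤ c.a
  g_nonneg : 0 ≤ c.g
  x_nonneg : 0 ≤ c.x
  avg : (l.map fun t => if c.p t then c.x else 1).sum = l.length * c.g

theorem Test.Fair.weight_nonneg {c : Test} {l : List ℕ} (h : c.Fair l) (k : ℕ) (ρ : List ℕ) :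
    0 ≤ c.weight k ρ :=
  mul_nonneg (mul_nonneg h.a_nonneg (pow_nonneg h.g_nonneg _)) (pow_nonneg h.x_nonneg _)

theorem sum_range_getD {β : Type*} (l : List β) (d : β) (f : β → ℝ) :
    ∑ v ∈ Finset.range l.length, f (l.getD v d) = (l.map f).sum := by
  induction l with
  | nil => simp
  | cons b l ih =>
    rw [List.length_cons, Finset.sum_range_succ', List.map_cons, List.sum_cons, ← ih, add_comm]
    rfl

/-- A draw multiplies the weight by `c.x` or by 1, and on average by `c.g`, which replaces the
factor `c.g` of the missing draw. This is the martingale property. -/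
theorem Test.Fair.sum_weight {c : Test} {l : List ℕ} (h : c.Fair l) (k : ℕ) (ρ : List ℕ) :
    ∑ v ∈ Finset.range l.length, c.weight k (ρ ++ [l.getD v 0]) =
      l.length * c.weight (k + 1) ρ := by
  have key : ∀ t, c.weight k (ρ ++ [t]) =
      (c.a * c.g ^ k * c.x ^ ρ.countP c.p) * if c.p t then c.x else 1 := by
    intro t
    rw [Test.weight, List.countP_append, List.countP_singleton, pow_add, ← mul_assoc]
    split_ifs <;> simp
  simp only [key]
  rw [← Finset.mul_sum, sum_range_getD l 0 fun t => if c.p t then c.x else 1, h.avg, Test.weight]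
  ring

/-- The total weight of a finite family of tests. -/
noncomputable def potential (C : List Test) (k : ℕ) (ρ : List ℕ) : ℝ :=
  (C.map fun c => c.weight k ρ).sum

theorem potential_nonneg {C : List Test} {l : List ℕ} (h : ∀ c ∈ C, c.Fair l) (k : ℕ)
    (ρ : List ℕ) : 0 ≤ potential C k ρ := by
  refine List.sum_nonneg fun y hy => ?_
  obtain ⟨c, hc, rfl⟩ := List.mem_map.1 hy
  exact (h c hc).weight_nonneg k ρ

theorem sum_potential {C : List Test} {l : List ℕ} (h : ∀ c ∈ C, c.Fair l) (k : ℕ)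
    (ρ : List ℕ) : ∑ v ∈ Finset.range l.length, potential C k (ρ ++ [l.getD v 0]) =
      l.length * potential C (k + 1) ρ := by
  induction C with
  | nil => simp [potential]
  | cons c C ih =>
    have h1 := (h c (by simp)).sum_weight k ρ
    have h2 := ih fun c' hc' => h c' (by simp [hc'])
    simp only [potential, List.map_cons, List.sum_cons, Finset.sum_add_distrib, mul_add] at *
    rw [h1, h2]

theorem le_potential {C : List Test} {l : List ℕ} (h : ∀ c ∈ C, c.Fair l) {c : Test} (hc : c ∈ C)
    (k : ℕ) (ρ : List ℕ) : c.weight k ρ ≤ potential C k ρ := by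
  refine List.single_le_sum (fun y hy => ?_) _ (List.mem_map.2 ⟨c, hc, rfl⟩)
  obtain ⟨c, hc, rfl⟩ := List.mem_map.1 hy
  exact (h c hc).weight_nonneg k ρ

section

variable {W : ℕ} {D : ℕ → ℕ → ℝ} {G : State → Prop} {Post : Assertion} {s : State} {T : ℕ} {ε : ℝ}
variable {n : ℕ} {α : ℝ}

/-- While drawing, the error budget is at least `β` plus the potential of the partial sample. The
part `β` is reserved for the rest of the program. -/
theorem wp_drawCmd {l : List ℕ} {c q : ℕ} (hT : 10 * (c * q) + 7 ≤ T) (h0 : s.reg 0 = n)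
    (h1 : s.reg 1 = 1) (h6 : s.reg 6 = l.length) (h22 : s.reg 22 = c)
    (hq : s.reg 6 / s.reg 7 = q) (hW : n + c * q < W) (hln : l.length ≤ n)
    (hmem : Stores s.mem 0 l) (hl : ∀ t ∈ l, t < W)
    (C : List Test) (hC : ∀ c ∈ C, c.Fair l) {β : ℝ} (hβ : 0 ≤ β)
    (hε : β + potential C (c * q) [] ≤ ε)
    (h : ∀ s' ρ, Frame [9, 11, 13, 15, 16] s s' → Stores s'.mem 0 l → Stores s'.mem n ρ →
      s'.out = s.out → s'.reg 9 = c * q → ρ.length = c * q → (∀ t ∈ ρ, t ∈ l) →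
      ∀ ε', β + potential C 0 ρ ≤ ε' → Post s' (T - (10 * (c * q) + 7)) ε') :
    drawCmd.wp W D G Post s T ε := by
  have hqn : q ≤ n := by
    rw [← hq, h6]
    exact (Nat.div_le_self _ _).trans hln
  have b1 : (c * q) % W = c * q := Nat.mod_eq_of_lt (by omega)
  have b2 : q % W = q := Nat.mod_eq_of_lt (by omega)
  refine Cmd.wp_seq (by omega) (Cmd.wp_exec rfl (by simp [Cmd.cost, Cmd.block]; omega) ?_)
  refine Cmd.wp_loop (fun s' T' ε' => ∃ ρ : List ℕ, ρ.length ≤ c * q ∧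
    Frame [9, 11, 13, 15, 16] s s' ∧ Stores s'.mem 0 l ∧ Stores s'.mem n ρ ∧
    s'.out = s.out ∧ s'.reg 9 = c * q ∧ s'.reg 11 = ρ.length ∧ (∀ t ∈ ρ, t ∈ l) ∧
    T' = 10 * (c * q - ρ.length) + 1 + (T - (10 * (c * q) + 7)) ∧
    β + potential C (c * q - ρ.length) ρ ≤ ε') ?_ ?_
  · refine ⟨[], by simp, ⟨?_, rfl⟩, ?_, ?_, rfl, ?_, ?_, by simp, ?_, ?_⟩
    · intro r hr
      simp at hr
      simp [Cmd.exec, Cmd.block, hr]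
    · exact hmem
    · intro i hi
      simp at hi
    · simp [Cmd.exec, Cmd.block, ArithOp.eval, hq, h22, b1, b2]
    · simp [Cmd.exec, Cmd.block]
    · simp [Cmd.cost, Cmd.block]; omega
    · simpa using hε
  · rintro s' T' ε' ⟨ρ, hlen, hF, hm, hm', ho, h9, h11, hρ, rfl, hε'⟩
    have e0 := hF.1 0 (by decide)
    have e1 := hF.1 1 (by decide)
    have e6 := hF.1 6 (by decide)
    refine ⟨by omega, fun hlt => ?_, fun hle => ?_⟩
    · have hlt' : ρ.length < c * q := by omega
      obtain ⟨k, hk⟩ : ∃ k, c * q - ρ.length = k + 1 := ⟨c * q - ρ.length - 1, by omega⟩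
      -- An empty list has `q = 0`, so no draw is ever attempted from it.
      have hlpos : 0 < l.length := by
        by_contra hl0
        have : l.length = 0 := by omega
        rw [h6, this, Nat.zero_div] at hq
        subst hq
        omega
      refine Cmd.wp_seq (by omega) ?_
      refine Cmd.wp_rand (fun v => β + potential C k (ρ ++ [l.getD v 0])) (by omega) (by omega)
        (fun v _ => add_nonneg hβ (potential_nonneg hC _ _)) ?_ fun v hv => ?_
      · rw [e6, h6, Finset.sum_add_distrib, sum_potential hC, Finset.sum_const, Finset.card_range,
          nsmul_eq_mul, ← mul_add, ← hk]
        gcongr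
      · have hv' : v < l.length := by omega
        refine Cmd.wp_exec rfl (by simp [drawTail, Cmd.block, Cmd.cost]; omega) ?_
        have c1 : v % W = v := Nat.mod_eq_of_lt (by omega)
        have c2 : l[v] % W = l[v] := Nat.mod_eq_of_lt (hl _ (List.getElem_mem hv'))
        have c3 : (n + ρ.length) % W = n + ρ.length := Nat.mod_eq_of_lt (by omega)
        have c4 : (ρ.length + 1) % W = ρ.length + 1 := Nat.mod_eq_of_lt (by omega)
        have hget : l.getD v 0 = l[v] := List.getD_eq_getElem _ _ hv'
        have hmv : s'.mem v = l[v] := by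
          have := hm v hv'
          rwa [Nat.zero_add] at this
        have hmem' : (drawTail.exec W D (s'.setReg W 16 v)).mem =
            Function.update s'.mem (n + ρ.length) l[v] := by
          simp [drawTail, Cmd.block, Cmd.exec, ArithOp.eval, e0, h0, h11, c1, c2, c3, hmv]
        rw [hget]
        refine ⟨ρ ++ [l[v]], ?_, ⟨fun r hr => ?_, ?_⟩, ?_, ?_, ?_, ?_, ?_, ?_, ?_, ?_⟩
        · simp; omega
        · simp at hr
          simp [drawTail, Cmd.block, Cmd.exec, hr, ← hF.1 r (by simp [hr])]
        · simp [drawTail, Cmd.block, Cmd.exec, hF.2]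
        · intro i hi
          rw [hmem', Function.update_apply, if_neg (by omega)]
          exact hm i hi
        · intro i hi
          rw [List.length_append, List.length_singleton] at hi
          rw [hmem', Function.update_apply]
          rcases Nat.lt_or_ge i ρ.length with hi' | hi'
          · rw [if_neg (by omega), List.getElem_append_left hi']
            exact hm' i hi'
          · have : i = ρ.length := by omega
            subst this
            simp
        · simp [drawTail, Cmd.block, Cmd.exec, ho]
        · simp [drawTail, Cmd.block, Cmd.exec, h9]
        · simp [drawTail, Cmd.block, Cmd.exec, ArithOp.eval, h11, e1, h1, c4]
        · intro t ht
          rcases List.mem_append.1 ht with ht | ht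
          · exact hρ t ht
          · rw [List.mem_singleton.1 ht]
            exact List.getElem_mem hv'
        · simp [drawTail, Cmd.block, Cmd.cost]; omega
        · rw [List.length_append, List.length_singleton]
          have : c * q - (ρ.length + 1) = k := by omega
          rw [this]
    · have hlen' : ρ.length = c * q := by omega
      rw [hlen', Nat.sub_self] at hε'
      have := h s' ρ hF hm hm' ho h9 hlen' hρ ε' hε'
      convert this using 1
      omega

end

/-! ### The quality of a random sample -/

/-- The counts in the sample `ρ` of `l` reflect the number of elements of `l` that are covered. -/
def GoodSample (cov : ℕ → ℕ → Bool) (n L τ : ℕ) (l ρ : List ℕ) : Prop :=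
  ∀ u < n, (l.countP (cov u) < 2 * τ → ρ.countP (cov u) ≤ 1040 * L) ∧
    (32 * l.countP (cov u) < τ → ρ.countP (cov u) < 32 * L) ∧
    (τ ≤ l.countP (cov u) → 32 * L ≤ ρ.countP (cov u))

/-- The fraction of the elements of `l` that satisfy `p`. -/
noncomputable def fraction (p : ℕ → Bool) (l : List ℕ) : ℝ := l.countP p / l.length

/-- The test for more than `θ` occurrences. -/
noncomputable def upperTest (p : ℕ → Bool) (l : List ℕ) (P : Prop) [Decidable P] (θ : ℕ) : Test :=
  ⟨p, if P then (1 / 2) ^ θ else 0, 1 + fraction p l, 2⟩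

/-- The test for fewer than `θ` occurrences. -/
noncomputable def lowerTest (p : ℕ → Bool) (l : List ℕ) (P : Prop) [Decidable P] (θ : ℕ) : Test :=
  ⟨p, if P then 2 ^ θ else 0, 1 - fraction p l / 2, 1 / 2⟩

theorem fraction_nonneg (p : ℕ → Bool) (l : List ℕ) : 0 ≤ fraction p l := by
  unfold fraction
  positivity

theorem fraction_le_one (p : ℕ → Bool) (l : List ℕ) : fraction p l ≤ 1 :=
  div_le_one_of_le₀ (by exact_mod_cast List.countP_le_length) (by positivity)

theorem sum_map_ite (p : ℕ → Bool) (x : ℝ) (l : List ℕ) :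
    (l.map fun t => if p t then x else 1).sum = l.length * (1 + fraction p l * (x - 1)) := by
  have h : (l.map fun t => if p t then x else 1).sum = l.length + l.countP p * (x - 1) := by
    induction l with
    | nil => simp
    | cons t l ih =>
      rw [List.map_cons, List.sum_cons, ih, List.countP_cons, List.length_cons]
      split_ifs <;> push_cast <;> ring
  rw [h]
  rcases l with _ | ⟨t, l⟩
  · simp
  · have : ((t :: l).length : ℝ) ≠ 0 := by simp; positivity
    rw [fraction]
    field_simp

theorem upperTest_fair (p : ℕ → Bool) (l : List ℕ) (P : Prop) [Decidable P] (θ : ℕ) :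
    (upperTest p l P θ).Fair l := by
  refine ⟨?_, ?_, by simp [upperTest], ?_⟩
  · simp only [upperTest]
    split_ifs <;> positivity
  · have := fraction_nonneg p l
    simp only [upperTest]
    positivity
  · simp only [upperTest]
    exact (sum_map_ite p 2 l).trans (by ring)

theorem lowerTest_fair (p : ℕ → Bool) (l : List ℕ) (P : Prop) [Decidable P] (θ : ℕ) :
    (lowerTest p l P θ).Fair l := by
  refine ⟨?_, ?_, by simp [lowerTest], ?_⟩
  · simp only [lowerTest]
    split_ifs <;> positivity
  · have := fraction_le_one p l
    simp only [lowerTest]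
    linarith
  · simp only [lowerTest]
    exact (sum_map_ite p (1 / 2) l).trans (by ring)

theorem exp_le_four_pow (k : ℕ) : Real.exp k ≤ 4 ^ k := by
  rw [← mul_one (k : ℝ), Real.exp_nat_mul]
  have := Real.exp_one_lt_d9
  gcongr
  linarith

/-- A Chernoff bound: with `f` the fraction and mean `m * f ≤ k`, the moment `(1 + f) ^ m` is at
most `exp k ≤ 4 ^ k = 2 ^ (2 * k)`, and a threshold `θ ≥ 2 * k + b` leaves `2 ^ (-b)`. -/
theorem upperTest_weight_le {p : ℕ → Bool} {l : List ℕ} {P : Prop} [Decidable P] {θ m k b : ℕ}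
    (h : P → m * fraction p l ≤ k) (hb : 2 * k + b ≤ θ) :
    (upperTest p l P θ).weight m [] ≤ (1 / 2) ^ b := by
  simp only [upperTest, Test.weight, List.countP_nil, pow_zero, mul_one]
  split_ifs with hP
  · have h1 : (1 + fraction p l) ^ m ≤ 4 ^ k := by
      calc (1 + fraction p l) ^ m ≤ Real.exp (fraction p l) ^ m := by
            have := fraction_nonneg p l
            gcongr
            linarith [Real.add_one_le_exp (fraction p l)]
        _ = Real.exp (m * fraction p l) := (Real.exp_nat_mul _ _).symm
        _ ≤ Real.exp k := Real.exp_le_exp.2 (h hP)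
        _ ≤ 4 ^ k := exp_le_four_pow k
    calc (1 / 2 : ℝ) ^ θ * (1 + fraction p l) ^ m ≤ (1 / 2) ^ (2 * k + b) * 4 ^ k := by
          have : (1 / 2 : ℝ) ^ θ ≤ (1 / 2) ^ (2 * k + b) :=
            pow_le_pow_of_le_one (by norm_num) (by norm_num) hb
          gcongr
          have := fraction_nonneg p l
          positivity
      _ = (1 / 2) ^ b := by
          rw [pow_add, pow_mul, mul_right_comm, ← mul_pow]
          norm_num
  · rw [zero_mul]
    positivity

/-- The lower-tail counterpart, from `(1 - f / 2) ^ m ≤ exp (-m * f / 2) ≤ exp (-k) ≤ 2 ^ (-k)`. -/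
theorem lowerTest_weight_le {p : ℕ → Bool} {l : List ℕ} {P : Prop} [Decidable P] {θ m k b : ℕ}
    (h : P → (k : ℝ) ≤ m * (fraction p l / 2)) (hb : θ + b ≤ k) :
    (lowerTest p l P θ).weight m [] ≤ (1 / 2) ^ b := by
  simp only [lowerTest, Test.weight, List.countP_nil, pow_zero, mul_one]
  split_ifs with hP
  · have h1 : (1 - fraction p l / 2) ^ m ≤ (1 / 2) ^ k := by
      calc (1 - fraction p l / 2) ^ m ≤ Real.exp (-(fraction p l / 2)) ^ m := by
            have := fraction_le_one p l
            gcongr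
            · linarith
            · linarith [Real.add_one_le_exp (-(fraction p l / 2))]
        _ = Real.exp (-(m * (fraction p l / 2))) := by
            rw [← Real.exp_nat_mul]
            ring_nf
        _ ≤ Real.exp (-k) := Real.exp_le_exp.2 (by linarith [h hP])
        _ = Real.exp (-1) ^ k := by rw [← Real.exp_nat_mul]; ring_nf
        _ ≤ (1 / 2) ^ k := by
            gcongr
            rw [Real.exp_neg, one_div]
            have := Real.exp_one_gt_d9
            gcongr
            linarith
    calc (2 : ℝ) ^ θ * (1 - fraction p l / 2) ^ m ≤ 2 ^ θ * (1 / 2) ^ (θ + b) := by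
          have : (1 / 2 : ℝ) ^ k ≤ (1 / 2) ^ (θ + b) :=
            pow_le_pow_of_le_one (by norm_num) (by norm_num) hb
          gcongr
          exact h1.trans this
      _ = (1 / 2) ^ b := by
          rw [pow_add, ← mul_assoc, ← mul_pow]
          norm_num
  · rw [zero_mul]
    positivity

theorem one_le_upperTest_weight {p : ℕ → Bool} {l ρ : List ℕ} {P : Prop} [Decidable P] {θ : ℕ}
    (hP : P) (h : θ ≤ ρ.countP p) : 1 ≤ (upperTest p l P θ).weight 0 ρ := by
  simp only [upperTest, Test.weight, if_pos hP, pow_zero, mul_one]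
  calc (1 : ℝ) = (1 / 2) ^ θ * 2 ^ θ := by rw [← mul_pow]; norm_num
    _ ≤ _ := by gcongr; norm_num

theorem one_le_lowerTest_weight {p : ℕ → Bool} {l ρ : List ℕ} {P : Prop} [Decidable P] {θ : ℕ}
    (hP : P) (h : ρ.countP p ≤ θ) : 1 ≤ (lowerTest p l P θ).weight 0 ρ := by
  simp only [lowerTest, Test.weight, if_pos hP, pow_zero, mul_one]
  calc (1 : ℝ) = 2 ^ θ * (1 / 2) ^ θ := by rw [← mul_pow]; norm_num
    _ ≤ _ := by
      gcongr 2 ^ θ * ?_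
      exact pow_le_pow_of_le_one (by norm_num) (by norm_num) h

/-- The tests whose success makes a sample good. -/
noncomputable def sampleTests (cov : ℕ → ℕ → Bool) (n L τ : ℕ) (l : List ℕ) : List Test :=
  (List.range n).flatMap fun u =>
    [upperTest (cov u) l (l.countP (cov u) < 2 * τ) (1040 * L),
      upperTest (cov u) l (32 * l.countP (cov u) < τ) (32 * L),
      lowerTest (cov u) l (τ ≤ l.countP (cov u)) (32 * L)]

theorem sampleTests_fair (cov : ℕ → ℕ → Bool) (n L τ : ℕ) (l : List ℕ) :
    ∀ c ∈ sampleTests cov n L τ l, c.Fair l := by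
  intro c hc
  simp only [sampleTests, List.mem_flatMap, List.mem_cons, List.not_mem_nil, or_false] at hc
  obtain ⟨u, -, rfl | rfl | rfl⟩ := hc
  · exact upperTest_fair _ _ _ _
  · exact upperTest_fair _ _ _ _
  · exact lowerTest_fair _ _ _ _

/-- The Markov step: each violated requirement makes the final weight of its test at least 1, and
the other weights are nonnegative. -/
theorem goodSample_or_one_le (cov : ℕ → ℕ → Bool) (n L τ : ℕ) (l ρ : List ℕ) :
    GoodSample cov n L τ l ρ ∨ 1 ≤ potential (sampleTests cov n L τ l) 0 ρ := by
  by_contra! hcon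
  obtain ⟨h1, h2⟩ := hcon
  refine h1 fun u hu => ?_
  have hmem : ∀ c ∈ [upperTest (cov u) l (l.countP (cov u) < 2 * τ) (1040 * L),
      upperTest (cov u) l (32 * l.countP (cov u) < τ) (32 * L),
      lowerTest (cov u) l (τ ≤ l.countP (cov u)) (32 * L)], c.weight 0 ρ < 1 := fun c hc =>
    (le_potential (sampleTests_fair cov n L τ l)
      (List.mem_flatMap.2 ⟨u, List.mem_range.2 hu, hc⟩) 0 ρ).trans_lt h2
  refine ⟨fun hr => ?_, fun hr => ?_, fun hr => ?_⟩ <;> by_contra! hlt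
  · exact absurd (one_le_upperTest_weight (l := l) hr hlt.le) (not_le.2 (hmem _ (by simp)))
  · exact absurd (one_le_upperTest_weight (l := l) hr hlt) (not_le.2 (hmem _ (by simp)))
  · exact absurd (one_le_lowerTest_weight (l := l) hr hlt.le) (not_le.2 (hmem _ (by simp)))

/-- The error budget for one sample. -/
noncomputable def sampleError (n L : ℕ) : ℝ := 3 * n * (1 / 2) ^ (16 * L)

/-- Bounds the expected number of hits, using `⌊|l| / τ⌋ * τ ≤ |l|`. -/
theorem mul_fraction_le {p : ℕ → Bool} {l : List ℕ} {τ a b L : ℕ} (hτ : 0 < τ)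
    (h : 256 * l.countP p ≤ b * τ) (ha : a = b * L) :
    ((256 * L * (l.length / τ) : ℕ) : ℝ) * fraction p l ≤ a := by
  subst ha
  rcases Nat.eq_zero_or_pos l.length with h0 | h0
  · rw [h0]
    simp
    positivity
  · have hq : (l.length / τ) * τ ≤ l.length := Nat.div_mul_le_self _ _
    rw [fraction, mul_div_assoc', div_le_iff₀ (by exact_mod_cast h0)]
    norm_cast
    refine Nat.le_of_mul_le_mul_right ?_ hτ
    calc 256 * L * (l.length / τ) * l.countP p * τ
        = L * (l.length / τ * τ) * (256 * l.countP p) := by ring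
      _ ≤ L * l.length * (b * τ) := by gcongr
      _ = b * L * l.length * τ := by ring

/-- Since `τ ≤ |l|`, rounding the quotient down loses at most a factor 2, so at least `128 * L` hits
are expected. -/
theorem le_mul_fraction {p : ℕ → Bool} {l : List ℕ} {τ L : ℕ} (hτ : 0 < τ)
    (h : τ ≤ l.countP p) :
    ((64 * L : ℕ) : ℝ) ≤ ((256 * L * (l.length / τ) : ℕ) : ℝ) * (fraction p l / 2) := by
  have hl : τ ≤ l.length := h.trans List.countP_le_length
  have hq : l.length ≤ 2 * ((l.length / τ) * τ) := by
    have h1 := Nat.lt_div_mul_add (a := l.length) hτ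
    have h2 : τ ≤ l.length / τ * τ := Nat.le_mul_of_pos_left _ (Nat.div_pos hl hτ)
    omega
  have h0 : (0 : ℝ) < l.length := by
    have : 0 < l.length := by omega
    exact_mod_cast this
  rw [fraction, div_div, mul_div_assoc', le_div_iff₀ (by positivity)]
  norm_cast
  calc 64 * L * (l.length * 2) ≤ 64 * L * (2 * (l.length / τ * τ) * 2) := by gcongr
    _ ≤ 64 * L * (2 * (l.length / τ * l.countP p) * 2) := by gcongr
    _ = 256 * L * (l.length / τ) * l.countP p := by ring

theorem potential_sampleTests_le (cov : ℕ → ℕ → Bool) (n L : ℕ) {τ : ℕ} (hτ : 0 < τ)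
    (l : List ℕ) : potential (sampleTests cov n L τ l) (256 * L * (l.length / τ)) [] ≤
      sampleError n L := by
  have key : ∀ c ∈ sampleTests cov n L τ l,
      c.weight (256 * L * (l.length / τ)) [] ≤ (1 / 2) ^ (16 * L) := by
    intro c hc
    simp only [sampleTests, List.mem_flatMap, List.mem_cons, List.not_mem_nil, or_false] at hc
    obtain ⟨u, -, rfl | rfl | rfl⟩ := hc
    -- A count below `2 * τ` gives mean at most `512 * L`, and `2 * 512 + 16 = 1040`.
    · exact upperTest_weight_le (k := 512 * L)
        (fun hr => mul_fraction_le hτ (b := 512) (by omega) rfl) (by omega)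
    -- A count below `τ / 32` gives mean at most `8 * L`, and `2 * 8 + 16 = 32`.
    · exact upperTest_weight_le (k := 8 * L)
        (fun hr => mul_fraction_le hτ (b := 8) (by omega) rfl) (by omega)
    -- Here half the mean is at least `64 * L`, which exceeds the required `32 * L + 16 * L`.
    · exact lowerTest_weight_le (k := 64 * L) (fun hr => le_mul_fraction hτ hr) (by omega)
  have hlen : (sampleTests cov n L τ l).length = n * 3 := by
    simp [sampleTests, List.length_flatMap]
  refine (List.sum_le_card_nsmul _ ((1 / 2) ^ (16 * L)) fun x hx => ?_).trans ?_
  · obtain ⟨c, hc, rfl⟩ := List.mem_map.1 hx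
    exact key c hc
  · rw [List.length_map, hlen, nsmul_eq_mul, sampleError]
    push_cast
    apply le_of_eq
    ring

/-! ### Invariants of the treatment of one source -/

/-- The targets other than `sv` that are covered by no element of `es`. -/
def uncovered (cov : ℕ → ℕ → Bool) (n sv : ℕ) (es : List ℕ) : List ℕ :=
  (List.range n).filter fun t => decide (t ≠ sv) && es.all fun u => !cov u t

theorem uncovered_cons (cov : ℕ → ℕ → Bool) (n sv u : ℕ) (es : List ℕ) :
    uncovered cov n sv (u :: es) = (uncovered cov n sv es).filter fun t => !cov u t := by
  rw [uncovered, uncovered, List.filter_filter]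
  refine List.filter_congr fun t _ => ?_
  rw [List.all_cons]
  cases decide (t ≠ sv) <;> cases cov u t <;> simp

theorem mem_uncovered {cov : ℕ → ℕ → Bool} {n sv t : ℕ} {es : List ℕ} :
    t ∈ uncovered cov n sv es ↔ t < n ∧ t ≠ sv ∧ ∀ u ∈ es, cov u t = false := by
  simp [uncovered]

theorem length_uncovered_le (cov : ℕ → ℕ → Bool) (n sv : ℕ) (es : List ℕ) :
    (uncovered cov n sv es).length ≤ n :=
  (List.length_filter_le _ _).trans (by simp)

theorem length_uncovered_cons (cov : ℕ → ℕ → Bool) (n sv u : ℕ) (es : List ℕ) :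
    (uncovered cov n sv es).length =
      (uncovered cov n sv (u :: es)).length + (uncovered cov n sv es).countP (cov u) := by
  rw [uncovered_cons, ← List.countP_eq_length_filter, add_comm]
  exact List.length_eq_countP_add_countP (cov u) |>.trans (by simp)

theorem countP_uncovered_cons_le (cov : ℕ → ℕ → Bool) (n sv u : ℕ) (es : List ℕ)
    (p : ℕ → Bool) :
    (uncovered cov n sv (u :: es)).countP p ≤ (uncovered cov n sv es).countP p := by
  rw [uncovered_cons]
  exact List.Sublist.countP_le List.filter_sublist

theorem countP_uncovered_cons_self (cov : ℕ → ℕ → Bool) (n sv u : ℕ) (es : List ℕ) :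
    (uncovered cov n sv (u :: es)).countP (cov u) = 0 := by
  rw [uncovered_cons, List.countP_eq_zero]
  intro t ht
  simpa using (List.mem_filter.1 ht).2

/-- The words are long enough for all numbers that occur. -/
structure WordBounds (n L W : ℕ) : Prop where
  two_le : 2 ≤ n
  pos : 1 ≤ L
  lt_pow : n < 2 ^ L
  memory : n + 256 * L * n < W
  const : 1040 * L < W
  pow : 2 ^ (L + 1) < W
  scale : 2000 * n < W

/-- The registers that are set up once and for all. -/
structure Env (n L : ℕ) (α : ℝ) (s : State) : Prop where
  r0 : s.reg 0 = n
  r1 : s.reg 1 = 1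
  r2 : s.reg 2 = 0
  r4 : s.reg 4 = 2 ^ L
  r20 : s.reg 20 = 32 * L
  r21 : s.reg 21 = 1040 * L
  r22 : s.reg 22 = 256 * L
  real0 : s.real 0 = α

theorem Env.frame {n L : ℕ} {α : ℝ} {F : List ℕ} {s s' : State} (h : Env n L α s)
    (hF : Frame F s s') (h0 : ∀ r ∈ [0, 1, 2, 4, 20, 21, 22], r ∉ F := by decide) :
    Env n L α s' where
  r0 := (hF.1 0 (h0 0 (by simp))).trans h.r0
  r1 := (hF.1 1 (h0 1 (by simp))).trans h.r1
  r2 := (hF.1 2 (h0 2 (by simp))).trans h.r2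
  r4 := (hF.1 4 (h0 4 (by simp))).trans h.r4
  r20 := (hF.1 20 (h0 20 (by simp))).trans h.r20
  r21 := (hF.1 21 (h0 21 (by simp))).trans h.r21
  r22 := (hF.1 22 (h0 22 (by simp))).trans h.r22
  real0 := hF.2.trans h.real0

/-- The edges from `sv` to the points in `es` have been output, the previous output was `out₀`, and
the list in memory is up to date. -/
structure Progress (D : ℕ → ℕ → ℝ) (n L : ℕ) (α : ℝ) (sv : ℕ) (out₀ : List (ℕ × ℕ))
    (es : List ℕ) (s : State) : Prop where
  env : Env n L α s
  r5 : s.reg 5 = sv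
  r6 : s.reg 6 = (uncovered (covers D α sv) n sv es).length
  mem : Stores s.mem 0 (uncovered (covers D α sv) n sv es)
  out : s.out = es.map (fun u => (sv, u)) ++ out₀
  lt : ∀ u ∈ es, u < n

theorem Progress.frame {D : ℕ → ℕ → ℝ} {n L : ℕ} {α : ℝ} {sv : ℕ} {out₀ : List (ℕ × ℕ)}
    {es : List ℕ} {F : List ℕ} {s s' : State} (h : Progress D n L α sv out₀ es s)
    (hF : Frame F s s') (hm : Stores s'.mem 0 (uncovered (covers D α sv) n sv es))
    (ho : s'.out = s.out)
    (h0 : ∀ r ∈ [0, 1, 2, 4, 5, 6, 20, 21, 22], r ∉ F := by decide) :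
    Progress D n L α sv out₀ es s' where
  env := h.env.frame hF fun r hr => h0 r (by simp at hr ⊢; omega)
  r5 := (hF.1 5 (h0 5 (by simp))).trans h.r5
  r6 := (hF.1 6 (h0 6 (by simp))).trans h.r6
  mem := hm
  out := ho.trans h.out
  lt := h.lt

/-! ### Drawing a sample, taking a point, certifying a phase -/

section

variable {W : ℕ} {D : ℕ → ℕ → ℝ} {G : State → Prop} {Post : Assertion} {s : State} {T : ℕ} {ε : ℝ}
variable {n L : ℕ} {α : ℝ} {sv τ M : ℕ} {out₀ : List (ℕ × ℕ)} {es : List ℕ}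

theorem lt_of_mem_uncovered {cov : ℕ → ℕ → Bool} {n sv t : ℕ} {es : List ℕ}
    (h : t ∈ uncovered cov n sv es) : t < n := (mem_uncovered.1 h).1

/-- The sample `ρ` is stored in memory. -/
structure Sampled (D : ℕ → ℕ → ℝ) (n L : ℕ) (α : ℝ) (sv τ : ℕ) (es ρ : List ℕ) (s : State) :
    Prop where
  r9 : s.reg 9 = ρ.length
  mem : Stores s.mem n ρ
  len : ρ.length = 256 * L * ((uncovered (covers D α sv) n sv es).length / τ)
  sub : ∀ t ∈ ρ, t ∈ uncovered (covers D α sv) n sv es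

theorem Sampled.length_le {ρ : List ℕ} (h : Sampled D n L α sv τ es ρ s) :
    ρ.length ≤ 256 * L * n := by
  rw [h.len]
  gcongr
  exact (Nat.div_le_self _ _).trans (length_uncovered_le _ _ _ _)

/-- The time is charged by the uniform bound `M` rather than by the actual sample size. Afterwards
the budget has lost at most `sampleError`; if the sample is bad, it has a surplus of 1 instead. -/
theorem wp_sample (hb : WordBounds n L W) (hp : Progress D n L α sv out₀ es s) (h7 : s.reg 7 = τ)
    (hτ : 0 < τ) (hM : 256 * L * ((uncovered (covers D α sv) n sv es).length / τ) ≤ M)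
    (hT : 10 * M + 7 ≤ T) (hε : sampleError n L ≤ ε)
    (h : ∀ s' ρ ε', Frame [9, 11, 13, 15, 16] s s' → Progress D n L α sv out₀ es s' →
      Sampled D n L α sv τ es ρ s' → ε - sampleError n L ≤ ε' →
      (GoodSample (covers D α sv) n L τ (uncovered (covers D α sv) n sv es) ρ ∨
        ε - sampleError n L + 1 ≤ ε') → Post s' (T - (10 * M + 7)) ε') :
    drawCmd.wp W D G Post s T ε := by
  set l := uncovered (covers D α sv) n sv es with hl
  have hlen : l.length ≤ n := length_uncovered_le _ _ _ _
  have hlt : ∀ t ∈ l, t < n := fun t ht => lt_of_mem_uncovered ht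
  have hm := hb.memory
  have hqn : 256 * L * (l.length / τ) ≤ 256 * L * n := by
    gcongr
    exact (Nat.div_le_self _ _).trans hlen
  refine Cmd.wp_mono (T₀ := 10 * (256 * L * (l.length / τ)) + 7 + (T - (10 * M + 7))) (ε₀ := ε)
    (by omega) le_rfl (fun _ _ _ _ h => h) ?_
  refine wp_drawCmd (Nat.le_add_right _ _) hp.env.r0 hp.env.r1 hp.r6 hp.env.r22
    (by rw [hp.r6, h7]) (by omega) hlen hp.mem (fun t ht => by have := hlt t ht; omega)
    (sampleTests (covers D α sv) n L τ l) (sampleTests_fair _ _ _ _ _) (sub_nonneg.2 hε)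
    (by linarith [potential_sampleTests_le (covers D α sv) n L hτ l]) ?_
  intro s' ρ hF hm0 hm1 ho h9 hρlen hρ ε' hε'
  rw [Nat.add_sub_cancel_left]
  have hnn := potential_nonneg (sampleTests_fair (covers D α sv) n L τ l) 0 ρ
  refine h s' ρ ε' hF (hp.frame hF hm0 ho) ⟨h9.trans hρlen.symm, hm1, hρlen, hρ⟩ (by linarith) ?_
  exact (goodSample_or_one_le (covers D α sv) n L τ l ρ).imp_right fun h1 => by linarith

theorem wp_take (hb : WordBounds n L W) (hp : Progress D n L α sv out₀ es s) {u : ℕ}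
    (h7 : s.reg 7 = τ) (h8 : s.reg 8 = u) (hu : u < n)
    (hτ : 0 < τ) (hM : 256 * L * ((uncovered (covers D α sv) n sv es).length / τ) ≤ M)
    (hT : 18 * n + 10 * M + 24 ≤ T) (hε : sampleError n L ≤ ε)
    (hgiveUp : 32 * (uncovered (covers D α sv) n sv es).countP (covers D α sv u) < τ →
      ∀ s', Progress D n L α sv out₀ (u :: es) s' → s'.reg 7 = 0 → s'.reg 8 = n →
      Post s' (T - (18 * n + 10 * M + 24)) ε)
    (hgo : τ ≤ 32 * (uncovered (covers D α sv) n sv es).countP (covers D α sv u) →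
      ∀ s' ρ ε', Progress D n L α sv out₀ (u :: es) s' → s'.reg 7 = τ → s'.reg 8 = u →
      Sampled D n L α sv τ (u :: es) ρ s' → ε - sampleError n L ≤ ε' →
      (GoodSample (covers D α sv) n L τ (uncovered (covers D α sv) n sv (u :: es)) ρ ∨
        ε - sampleError n L + 1 ≤ ε') → Post s' (T - (18 * n + 10 * M + 24)) ε') :
    takeCmd.wp W D G Post s T ε := by
  set l := uncovered (covers D α sv) n sv es with hl
  have hlen : l.length ≤ n := length_uncovered_le _ _ _ _
  have hlt : ∀ t ∈ l, t < n := fun t ht => lt_of_mem_uncovered ht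
  have hm := hb.memory
  have hsc := hb.scale
  have htwo := hb.two_le
  have hcons : uncovered (covers D α sv) n sv (u :: es) = l.filter fun t => !covers D α sv u t :=
    uncovered_cons _ _ _ _ _
  have hsum := length_uncovered_cons (covers D α sv) n sv u es
  rw [← hl] at hsum
  refine Cmd.wp_mono (T₀ := 18 * l.length + 10 * M + 24 + (T - (18 * n + 10 * M + 24)))
    (by omega) le_rfl (fun _ _ _ _ h => h) ?_
  refine Cmd.wp_seq (by omega) (wp_filterCmd (l := l) (by omega) hp.env.r1 hp.r6 (by omega) (by omega)
    hp.mem (fun t ht => by have := hlt t ht; omega) ?_)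
  rw [hp.env.real0, hp.r5, h8, ← hcons]
  intro s₁ hF₁ hm₁ ho₁ h12
  refine Cmd.wp_seq (by omega) (Cmd.wp_exec rfl (by simp [Cmd.cost, Cmd.block]; omega) ?_)
  have e0 := (hF₁.1 0 (by decide)).trans hp.env.r0
  have e2 := (hF₁.1 2 (by decide)).trans hp.env.r2
  have e5 := (hF₁.1 5 (by decide)).trans hp.r5
  have e6 : s₁.reg 6 = l.length := (hF₁.1 6 (by decide)).trans hp.r6
  have e7 := (hF₁.1 7 (by decide)).trans h7
  have e8 := (hF₁.1 8 (by decide)).trans h8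
  -- The exact number of newly covered targets is a by-product of the filtering, so the check for
  -- giving up needs no further scan.
  have d1 : l.length - (uncovered (covers D α sv) n sv (u :: es)).length =
    l.countP (covers D α sv u) := by omega
  have d2 : l.countP (covers D α sv u) % W = l.countP (covers D α sv u) :=
    Nat.mod_eq_of_lt (by omega)
  have d3 : (uncovered (covers D α sv) n sv (u :: es)).length % W =
    (uncovered (covers D α sv) n sv (u :: es)).length := Nat.mod_eq_of_lt (by omega)
  have d4 : 32 % W = 32 := Nat.mod_eq_of_lt (by omega)
  have d5 : (l.countP (covers D α sv u) * 32) % W = l.countP (covers D α sv u) * 32 :=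
    Nat.mod_eq_of_lt (by omega)
  have d6 : n % W = n := Nat.mod_eq_of_lt (by omega)
  set s₂ := (Cmd.block [.arith .sub 16 6 12, .arith .add 6 12 2, .const 17 32,
    .arith .mul 16 16 17]).exec W D s₁ with hs₂
  have hF₂ : Frame [6, 16, 17] s₁ s₂ := by
    refine ⟨fun r hr => ?_, rfl⟩
    simp at hr
    simp [hs₂, Cmd.block, Cmd.exec, hr]
  have f6 : s₂.reg 6 = (uncovered (covers D α sv) n sv (u :: es)).length := by
    simp [hs₂, Cmd.block, Cmd.exec, ArithOp.eval, h12, e2, d3]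
  have f16 : s₂.reg 16 = l.countP (covers D α sv u) * 32 := by
    simp [hs₂, Cmd.block, Cmd.exec, ArithOp.eval, h12, e6, e2, d1, d2, d3, d4, d5]
  have f7 : s₂.reg 7 = τ := (hF₂.1 7 (by decide)).trans e7
  have f8 : s₂.reg 8 = u := (hF₂.1 8 (by decide)).trans e8
  have hF : Frame [6, 11, 12, 13, 14, 16, 17, 19] s s₂ := hF₁.trans hF₂
  have hp₂ : Progress D n L α sv out₀ (u :: es) s₂ := by
    refine ⟨hp.env.frame hF, (hF₂.1 5 (by decide)).trans e5, f6, hm₁, ?_, ?_⟩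
    · change s₁.out = _
      rw [ho₁, hp.out]
      rfl
    · intro v hv
      rcases List.mem_cons.1 hv with rfl | hv
      · exact hu
      · exact hp.lt v hv
  refine Cmd.wp_ite (by simp [Cmd.cost, Cmd.block]; omega) (fun hlt' => ?_) (fun hle => ?_)
  · refine Cmd.wp_mono (T₀ := 3 + (T - (18 * n + 10 * M + 24)))
      (by simp [Cmd.cost, Cmd.block]; omega) le_rfl (fun _ _ _ _ h => h) ?_
    refine Cmd.wp_exec rfl (by simp [Cmd.cost]) ?_
    rw [show 3 + (T - (18 * n + 10 * M + 24)) - (Cmd.seq (.const 7 0) (.arith .add 8 0 2)).cost =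
      T - (18 * n + 10 * M + 24) by simp [Cmd.cost]]
    have hF₃ : Frame [7, 8] s₂ ((Cmd.seq (.const 7 0) (.arith .add 8 0 2)).exec W D s₂) := by
      refine ⟨fun r hr => ?_, rfl⟩
      simp at hr
      simp [Cmd.exec, hr]
    have g0 := (hF₂.1 0 (by decide)).trans e0
    have g2 := (hF₂.1 2 (by decide)).trans e2
    refine hgiveUp (by omega) _ (hp₂.frame hF₃ hp₂.mem rfl) ?_ ?_
    · simp [Cmd.exec]
    · simp [Cmd.exec, ArithOp.eval, g0, g2, d6]
  · have hM' : 256 * L * ((uncovered (covers D α sv) n sv (u :: es)).length / τ) ≤ M := by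
      refine le_trans ?_ hM
      gcongr
      omega
    refine Cmd.wp_mono (T₀ := 10 * M + 7 + (T - (18 * n + 10 * M + 24)))
      (by simp [Cmd.cost, Cmd.block]; omega) le_rfl (fun _ _ _ _ h => h) ?_
    refine wp_sample hb hp₂ f7 hτ hM' (Nat.le_add_right _ _) hε ?_
    intro s₃ ρ ε' hF₃ hp₃ hρ hε' hgood
    rw [Nat.add_sub_cancel_left]
    exact hgo (by omega) s₃ ρ ε' hp₃ ((hF₃.1 7 (by decide)).trans f7)
      ((hF₃.1 8 (by decide)).trans f8) hρ hε' hgood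

/-- The loop is deterministic given the sample: if `τ` survives, the bound on the hits is certain,
whether or not the sample is good. The later bounds on every run rest on this. -/
theorem wp_certLoop (hb : WordBounds n L W) (hp : Progress D n L α sv out₀ es s) {ρ : List ℕ}
    (h7 : s.reg 7 = τ) (h8 : s.reg 8 = 0) (hρ : Sampled D n L α sv τ es ρ s)
    (hM : ρ.length ≤ M) (hT : n * (16 * M + 12) + 1 ≤ T)
    (h : ∀ s', Progress D n L α sv out₀ es s' → Sampled D n L α sv τ es ρ s' → s'.reg 8 = n →
      (s'.reg 7 = τ ∧ (∀ u < n, ρ.countP (covers D α sv u) ≤ 1040 * L) ∨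
        s'.reg 7 = 0 ∧ ∃ u < n, 1040 * L < ρ.countP (covers D α sv u)) →
      Post s' (T - (n * (16 * M + 12) + 1)) ε) :
    (Cmd.loop 8 0 certBody).wp W D G Post s T ε := by
  refine Cmd.wp_mono (T₀ := n * (16 * M + 12) + 1 + (T - (n * (16 * M + 12) + 1))) (ε₀ := ε)
    (by omega) le_rfl (fun _ _ _ _ h => h) ?_
  generalize T - (n * (16 * M + 12) + 1) = T₁ at *
  have hm := hb.memory
  have htwo := hb.two_le
  have hlen := hρ.length_le
  refine Cmd.wp_loop (fun s' T' ε' => ∃ i ≤ n, Frame [7, 8, 10, 11, 13, 14, 15, 19] s s' ∧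
    s'.mem = s.mem ∧ s'.out = s.out ∧ s'.reg 8 = i ∧
    (s'.reg 7 = τ ∧ (∀ u < i, ρ.countP (covers D α sv u) ≤ 1040 * L) ∨
        s'.reg 7 = 0 ∧ ∃ u < n, 1040 * L < ρ.countP (covers D α sv u)) ∧
    T' = (n - i) * (16 * M + 12) + 1 + T₁ ∧ ε' = ε) ?_ ?_
  · exact ⟨0, by omega, Frame.refl _ _, rfl, rfl, h8, Or.inl ⟨h7, by simp⟩, by simp, rfl⟩
  · rintro s' T' ε' ⟨i, hi, hF, hms, ho, h8', h7', rfl, rfl⟩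
    have hp' : Progress D n L α sv out₀ es s' := hp.frame hF (hms ▸ hp.mem) ho
    have hρ' : Sampled D n L α sv τ es ρ s' :=
      ⟨(hF.1 9 (by decide)).trans hρ.r9, hms ▸ hρ.mem, hρ.len, hρ.sub⟩
    refine ⟨by omega, fun hlt => ?_, fun hle => ?_⟩
    · rw [h8', hp'.env.r0] at hlt
      obtain ⟨k, hk⟩ : ∃ k, n - i = k + 1 := ⟨n - i - 1, by omega⟩
      have hk' : n - (i + 1) = k := by omega
      rw [hk, add_mul, one_mul]
      refine Cmd.wp_mono (T₀ := 16 * ρ.length + 11 + (k * (16 * M + 12) + 1 + T₁)) (ε₀ := ε')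
        (by omega) le_rfl (fun _ _ _ _ h => h) ?_
      refine Cmd.wp_seq (by omega) (wp_hitsCmd (ρ := ρ) (by omega) hp'.env.r0 hp'.env.r1 hρ'.r9
        (by omega) hρ'.mem (fun t ht => by
          have := lt_of_mem_uncovered (hρ.sub t ht)
          omega) ?_)
      rw [hp'.env.real0, hp'.r5, h8']
      intro s₁ hF₁ hm₁ ho₁ h10
      have hF₂ : Frame [7, 8, 10, 11, 13, 14, 15, 19] s s₁ := hF.trans hF₁
      have hp₁ := hp.frame hF₂ (hm₁ ▸ hms ▸ hp.mem) (ho₁.trans ho)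
      have e8 : s₁.reg 8 = i := (hF₁.1 8 (by decide)).trans h8'
      have e7 : s₁.reg 7 = s'.reg 7 := hF₁.1 7 (by decide)
      refine Cmd.wp_exec rfl (by simp [Cmd.cost]; omega) ?_
      have c1 : (i + 1) % W = i + 1 := Nat.mod_eq_of_lt (by omega)
      by_cases hbig : 1040 * L < ρ.countP (covers D α sv i)
      · have hbr : s₁.reg 21 < s₁.reg 10 := by rw [hp₁.env.r21, h10]; exact hbig
        refine ⟨i + 1, hlt, ⟨fun r hr => ?_, ?_⟩, ?_, ?_, ?_, Or.inr ⟨?_, i, hlt, hbig⟩, ?_, rfl⟩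
        · simp at hr
          simp [Cmd.exec, hbr, hr, ← hF₂.1 r (by simp [hr])]
        · simp [Cmd.exec, hbr, hF₂.2]
        · simp [Cmd.exec, hbr, hm₁, hms]
        · simp [Cmd.exec, hbr, ho₁, ho]
        · simp [Cmd.exec, hbr, ArithOp.eval, e8, hp₁.env.r1, c1]
        · simp [Cmd.exec, hbr]
        · simp [Cmd.cost, hk']; omega
      · have hbr : ¬ s₁.reg 21 < s₁.reg 10 := by rw [hp₁.env.r21, h10]; exact hbig
        refine ⟨i + 1, hlt, ⟨fun r hr => ?_, ?_⟩, ?_, ?_, ?_, ?_, ?_, rfl⟩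
        · simp at hr
          simp [Cmd.exec, hbr, hr, ← hF₂.1 r (by simp [hr])]
        · simp [Cmd.exec, hbr, hF₂.2]
        · simp [Cmd.exec, hbr, hm₁, hms]
        · simp [Cmd.exec, hbr, ho₁, ho]
        · simp [Cmd.exec, hbr, ArithOp.eval, e8, hp₁.env.r1, c1]
        · have e7' : ((Cmd.seq (.ite 21 10 (.const 7 0) (.const 19 0)) (.arith .add 8 8 1)).exec
              W D s₁).reg 7 = s'.reg 7 := by simp [Cmd.exec, hbr, e7]
          rw [e7']
          refine h7'.imp (fun h' => ⟨h'.1, fun u hu => ?_⟩) id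
          rcases Nat.lt_succ_iff_lt_or_eq.1 hu with hu | rfl
          · exact h'.2 u hu
          · exact not_lt.1 hbig
        · simp [Cmd.cost, hk']; omega
    · rw [h8', hp'.env.r0] at hle
      have : i = n := by omega
      subst this
      have := h s' hp' hρ' h8' h7'
      simpa using this

end

/-! ### Edges, time and error of a phase -/

section

variable {W : ℕ} {D : ℕ → ℕ → ℝ} {G : State → Prop} {Post : Assertion} {s : State} {T : ℕ} {ε : ℝ}
variable {n L : ℕ} {α : ℝ} {sv τ M : ℕ} {out₀ : List (ℕ × ℕ)} {es : List ℕ}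

theorem Cmd.wp_loop_of_le {a b : ℕ} {c : Cmd} (hT : 1 ≤ T) (hab : s.reg b ≤ s.reg a)
    (h : Post s (T - 1) ε) : (Cmd.loop a b c).wp W D G Post s T ε := by
  refine Cmd.wp_loop (fun s' T' ε' => s' = s ∧ T' = T ∧ ε' = ε) ⟨rfl, rfl, rfl⟩ ?_
  rintro s' T' ε' ⟨rfl, rfl, rfl⟩
  exact ⟨hT, fun hlt => absurd hlt (not_lt.2 hab), fun _ => h⟩

theorem sampleError_nonneg (n L : ℕ) : 0 ≤ sampleError n L := by
  unfold sampleError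
  positivity

/-- The loop invariant of the second half of a phase while it has not been given up: `i` points have
been tested, `b` more edges may be output. -/
structure PassActive (D : ℕ → ℕ → ℝ) (n L : ℕ) (α : ℝ) (sv τ M E T₁ : ℕ) (β : ℝ)
    (out₀ : List (ℕ × ℕ)) (i b : ℕ) (es ρ : List ℕ) (s : State) (T : ℕ) (ε : ℝ) : Prop where
  le : i ≤ n
  r8 : s.reg 8 = i
  r7 : s.reg 7 = τ
  progress : Progress D n L α sv out₀ es s
  sampled : Sampled D n L α sv τ es ρ s
  room : 256 * L * ((uncovered (covers D α sv) n sv es).length / τ) ≤ M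
  budget : 32 * (uncovered (covers D α sv) n sv es).length < b * τ
  edges : es.length + b ≤ E
  time : (n - i) * (16 * M + 11) + b * (18 * n + 10 * M + 24) + 1 + T₁ ≤ T
  error : β + b * sampleError n L ≤ ε
  good : (GoodSample (covers D α sv) n L τ (uncovered (covers D α sv) n sv es) ρ ∧
    ∀ u < i, (uncovered (covers D α sv) n sv es).countP (covers D α sv u) < τ) ∨
      β + b * sampleError n L + 1 ≤ ε

/-- The state after giving up. -/
structure PassStopped (D : ℕ → ℕ → ℝ) (n L : ℕ) (α : ℝ) (sv E T₁ : ℕ) (β : ℝ)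
    (out₀ : List (ℕ × ℕ)) (es : List ℕ) (s : State) (T : ℕ) (ε : ℝ) : Prop where
  r8 : s.reg 8 = n + 1
  r7 : s.reg 7 = 0
  progress : Progress D n L α sv out₀ es s
  edges : es.length ≤ E
  time : 1 + T₁ ≤ T
  error : β + 1 ≤ ε

/-- The number `b` of edges still allowed pays for the edges, for the time of filtering and
redrawing, and for the errors of the new samples. A point once dealt with stays below `τ`, because
counts only decrease as `U` shrinks; hence a single pass over the candidates is enough. -/
theorem wp_passLoop (hb : WordBounds n L W) (hτ : 0 < τ) {E T₁ b₀ : ℕ} {β : ℝ} {ρ₀ es₀ : List ℕ}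
    (hβ : 0 ≤ β) (hstart : PassActive D n L α sv τ M E T₁ β out₀ 0 b₀ es₀ ρ₀ s T ε)
    (h : ∀ s' es T' ε', Progress D n L α sv out₀ es s' → es.length ≤ E → T₁ ≤ T' →
      (s'.reg 7 = τ ∧ β ≤ ε' ∧ (uncovered (covers D α sv) n sv es).length ≤
          (uncovered (covers D α sv) n sv es₀).length ∧
        ((∀ u < n, (uncovered (covers D α sv) n sv es).countP (covers D α sv u) < τ) ∨
          β + 1 ≤ ε') ∨
       s'.reg 7 = 0 ∧ β + 1 ≤ ε') → Post s' T' ε') :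
    (Cmd.loop 8 0 passBody).wp W D G Post s T ε := by
  have hm := hb.memory
  have htwo := hb.two_le
  have hδ := sampleError_nonneg n L
  refine Cmd.wp_loop (fun s' T' ε' => (∃ i b es ρ,
    PassActive D n L α sv τ M E T₁ β out₀ i b es ρ s' T' ε' ∧
    (uncovered (covers D α sv) n sv es).length ≤ (uncovered (covers D α sv) n sv es₀).length) ∨
    ∃ es, PassStopped D n L α sv E T₁ β out₀ es s' T' ε') ?_ ?_
  · exact Or.inl ⟨0, b₀, es₀, ρ₀, hstart, le_rfl⟩
  · rintro s' T' ε' (⟨i, b, es, ρ, hI, hle₀⟩ | ⟨es, hS⟩)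
    · have hp := hI.progress
      have hρ := hI.sampled
      have htime := hI.time
      have hroom := hI.room
      have hedges := hI.edges
      have hbudget := hI.budget
      have hlen := hρ.length_le
      have hρM : ρ.length ≤ M := hρ.len ▸ hroom
      -- The strict inequality in `budget` is what guarantees that one more edge can always be paid
      -- for.
      have hb1 : 1 ≤ b := by
        rcases Nat.eq_zero_or_pos b with rfl | hpos
        · simp at hbudget
        · exact hpos
      refine ⟨by omega, fun hlt => ?_, fun hle => ?_⟩
      · rw [hI.r8, hp.env.r0] at hlt
        obtain ⟨k, hk⟩ : ∃ k, n - i = k + 1 := ⟨n - i - 1, by omega⟩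
        obtain ⟨b, rfl⟩ := Nat.exists_eq_add_of_le' hb1
        have hk' : n - (i + 1) = k := by omega
        have c1 : (i + 1) % W = i + 1 := Nat.mod_eq_of_lt (by omega)
        rw [hk, add_mul k, one_mul, add_mul b, one_mul] at htime
        refine Cmd.wp_seq (by omega) (wp_hitsCmd (ρ := ρ) (by omega) hp.env.r0 hp.env.r1 hρ.r9
          (by omega) hρ.mem (fun t ht => by
            have := lt_of_mem_uncovered (hρ.sub t ht)
            omega) ?_)
        rw [hp.env.real0, hp.r5, hI.r8]
        intro s₁ hF₁ hm₁ ho₁ h10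
        have hp₁ := hp.frame hF₁ (hm₁ ▸ hp.mem) ho₁
        have e8 : s₁.reg 8 = i := (hF₁.1 8 (by decide)).trans hI.r8
        have e7 : s₁.reg 7 = τ := (hF₁.1 7 (by decide)).trans hI.r7
        have e9 : s₁.reg 9 = ρ.length := (hF₁.1 9 (by decide)).trans hρ.r9
        refine Cmd.wp_seq (by omega) (Cmd.wp_ite (by omega) (fun hbr => ?_) (fun hbr => ?_))
        · rw [h10, hp₁.env.r20] at hbr
          refine Cmd.wp_exec rfl (by simp [Cmd.cost]; omega)
            (Cmd.wp_exec rfl (by simp [Cmd.cost]; omega) (Or.inl ?_))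
          have hF₂ : Frame [8, 19] s₁
              ((Cmd.arith .add 8 8 1).exec W D ((Cmd.const 19 0).exec W D s₁)) := by
            refine ⟨fun r hr => ?_, rfl⟩
            simp at hr
            simp [Cmd.exec, hr]
          refine ⟨i + 1, b + 1, es, ρ, ⟨hlt, ?_, (hF₂.1 7 (by decide)).trans e7,
            hp₁.frame hF₂ hp₁.mem rfl, ⟨(hF₂.1 9 (by decide)).trans e9, ?_, hρ.len, hρ.sub⟩, hroom,
            hbudget, hedges, ?_, hI.error, ?_⟩, hle₀⟩
          · simp [Cmd.exec, ArithOp.eval, e8, hp₁.env.r1, c1]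
          · simpa [Cmd.exec, hm₁] using hρ.mem
          · rw [hk', add_mul b, one_mul]
            simp [Cmd.cost]; omega
          · refine hI.good.imp_left fun hg => ⟨hg.1, fun u hu => ?_⟩
            rcases Nat.lt_succ_iff_lt_or_eq.1 hu with hu | rfl
            · exact hg.2 u hu
            · by_contra hcon
              -- In a good sample, a skipped point cannot cover `τ` elements, as it would have had
              -- `32 * L` hits.
              have := (hg.1 u hlt).2.2 (not_lt.1 hcon)
              omega
        · rw [h10, hp₁.env.r20] at hbr
          have herr := hI.error
          have hgood := hI.good
          push_cast at herr hgood
          have hbδ : 0 ≤ (b : ℝ) * sampleError n L := by positivity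
          refine wp_take hb hp₁ e7 e8 hlt hτ hroom (by omega) (by nlinarith)
            (fun hfew s₂ hp₂ f7 f8 => ?_) (fun hmany s₂ ρ' ε₂ hp₂ f7 f8 hρ₂ hε₂ hgood₂ => ?_)
          · refine Cmd.wp_exec rfl (by simp [Cmd.cost]; omega) (Or.inr ⟨i :: es, ?_⟩)
            have hF₂ : Frame [8] s₂ ((Cmd.arith .add 8 8 1).exec W D s₂) := by
              refine ⟨fun r hr => ?_, rfl⟩
              simp at hr
              simp [Cmd.exec, hr]
            -- Giving up sets the counter to `n`, and the loop body still increments it.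
            have c2 : (n + 1) % W = n + 1 := Nat.mod_eq_of_lt (by
              have := hb.scale
              omega)
            refine ⟨?_, (hF₂.1 7 (by decide)).trans f7, hp₂.frame hF₂ hp₂.mem rfl, ?_, ?_, ?_⟩
            · simp [Cmd.exec, ArithOp.eval, f8, hp₂.env.r1, c2]
            · rw [List.length_cons]
              omega
            · simp [Cmd.cost]; omega
            · rcases hgood with hg | hg
              -- With a good sample, a point that covers too little has fewer than `32 * L` hits and
              -- would not have been taken.
              · have := (hg.1 i hlt).2.1 hfew
                omega
              · nlinarith
          · refine Cmd.wp_exec rfl (by simp [Cmd.cost]; omega) (Or.inl ?_)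
            have hF₂ : Frame [8] s₂ ((Cmd.arith .add 8 8 1).exec W D s₂) := by
              refine ⟨fun r hr => ?_, rfl⟩
              simp at hr
              simp [Cmd.exec, hr]
            have hsum := length_uncovered_cons (covers D α sv) n sv i es
            refine ⟨i + 1, b, i :: es, ρ', ⟨hlt, ?_, (hF₂.1 7 (by decide)).trans f7,
              hp₂.frame hF₂ hp₂.mem rfl, ⟨(hF₂.1 9 (by decide)).trans hρ₂.r9, hρ₂.mem, hρ₂.len,
                hρ₂.sub⟩, ?_, ?_, ?_, ?_, ?_, ?_⟩, by omega⟩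
            · simp [Cmd.exec, ArithOp.eval, f8, hp₂.env.r1, c1]
            · refine le_trans ?_ hroom
              gcongr
              omega
            · rw [add_mul, one_mul] at hbudget
              omega
            · rw [List.length_cons]
              omega
            · rw [hk']
              simp [Cmd.cost]; omega
            · linarith
            · rcases hgood with hg | hg
              · refine hgood₂.imp (fun hg₂ => ⟨hg₂, fun u hu => ?_⟩) fun hε' => by linarith
                rcases Nat.lt_succ_iff_lt_or_eq.1 hu with hu | rfl
                · exact (countP_uncovered_cons_le _ _ _ _ _ _).trans_lt (hg.2 u hu)
                · rw [countP_uncovered_cons_self]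
                  exact hτ
              · right
                linarith
      · rw [hI.r8, hp.env.r0] at hle
        have hbδ : 0 ≤ (b : ℝ) * sampleError n L := by positivity
        have herr := hI.error
        refine h s' es _ ε' hp (by omega) (by omega) (Or.inl ⟨hI.r7, by linarith, hle₀, ?_⟩)
        exact hI.good.imp (fun hg u hu => hg.2 u (by omega)) fun hg => by linarith
    · have htime := hS.time
      refine ⟨by omega, fun hlt => ?_, fun _ => ?_⟩
      · rw [hS.r8, hS.progress.env.r0] at hlt
        omega
      · exact h s' es _ ε' hS.progress hS.edges (by omega) (Or.inr ⟨hS.r7, hS.error⟩)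

/-- Every target other than `sv` is covered by a point of the list `Cv`. -/
def IsCover (cov : ℕ → ℕ → Bool) (n sv : ℕ) (Cv : List ℕ) : Prop :=
  (∀ u ∈ Cv, u < n) ∧ ∀ t < n, t ≠ sv → ∃ u ∈ Cv, cov u t = true

/-- A union bound with multiplicity: each entry of `ρ` is counted for at least one element of `Cv`.
-/
theorem length_le_sum_countP {cov : ℕ → ℕ → Bool} {Cv ρ : List ℕ}
    (h : ∀ t ∈ ρ, ∃ u ∈ Cv, cov u t = true) :
    ρ.length ≤ (Cv.map fun u => ρ.countP (cov u)).sum := by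
  induction ρ with
  | nil => simp
  | cons t ρ ih =>
    have ih := ih fun t ht => h t (List.mem_cons_of_mem _ ht)
    obtain ⟨u, hu, hut⟩ := h t List.mem_cons_self
    simp only [List.countP_cons, List.sum_map_add, List.length_cons]
    have : 1 ≤ (Cv.map fun u => if cov u t = true then 1 else 0).sum :=
      List.single_le_sum (by simp) 1 (List.mem_map.2 ⟨u, hu, by simp [hut]⟩)
    omega

/-- The sample is covered by `K = Cv.length` points with at most `1040 * L` hits each, so `256 *
⌊|l| / τ⌋ ≤ 1040 * K`. As `1040 / 256 < 5` and `K ≥ 1`, rounding up stays within `6 * K`. No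
probability is involved. -/
theorem length_uncovered_lt {cov : ℕ → ℕ → Bool} {Cv ρ : List ℕ} {l : List ℕ}
    (hcov : IsCover cov n sv Cv) (hτ : 0 < τ) (hL : 1 ≤ L) (hK : 1 ≤ Cv.length)
    (hl : ∀ t ∈ l, t < n ∧ t ≠ sv)
    (hlen : ρ.length = 256 * L * (l.length / τ)) (hsub : ∀ t ∈ ρ, t ∈ l)
    (hcert : ∀ u < n, ρ.countP (cov u) ≤ 1040 * L) : l.length < 6 * Cv.length * τ := by
  have h1 : ρ.length ≤ (Cv.map fun u => ρ.countP (cov u)).sum :=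
    length_le_sum_countP fun t ht => hcov.2 t (hl t (hsub t ht)).1 (hl t (hsub t ht)).2
  have h2 : (Cv.map fun u => ρ.countP (cov u)).sum ≤ Cv.length * (1040 * L) := by
    have := List.sum_le_card_nsmul (Cv.map fun u => ρ.countP (cov u)) (1040 * L) fun x hx => by
      obtain ⟨u, hu, rfl⟩ := List.mem_map.1 hx
      exact hcert u (hcov.1 u hu)
    simpa using this
  have h3 : 256 * (l.length / τ) ≤ 1040 * Cv.length := by
    refine Nat.le_of_mul_le_mul_right (c := L) ?_ hL
    calc 256 * (l.length / τ) * L = ρ.length := by rw [hlen]; ring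
      _ ≤ Cv.length * (1040 * L) := h1.trans h2
      _ = 1040 * Cv.length * L := by ring
  have h4 : l.length / τ + 1 ≤ 6 * Cv.length := by omega
  calc l.length < (l.length / τ + 1) * τ := by
        rw [add_mul, one_mul]
        exact Nat.lt_div_mul_add hτ
    _ ≤ 6 * Cv.length * τ := by gcongr

/-- The time for one phase. -/
def phaseTime (n L K : ℕ) : ℕ :=
  10 * (3072 * L * K) + 40 + n * (16 * (3072 * L * K) + 12) + n * (16 * (3072 * L * K) + 11) +
    192 * K * (18 * n + 10 * (3072 * L * K) + 24)

/-- The threshold when `J` phases remain. -/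
def threshold : ℕ → ℕ
  | 0 => 0
  | J + 1 => 2 ^ J

theorem threshold_div_two (J : ℕ) : threshold (J + 1) / 2 = threshold J := by
  cases J with
  | zero => rfl
  | succ J => simp [threshold, pow_succ]

/-- The invariant when `J` phases remain. -/
structure PhaseInv (D : ℕ → ℕ → ℝ) (n L : ℕ) (α : ℝ) (sv K E T₁ : ℕ) (β : ℝ)
    (out₀ : List (ℕ × ℕ)) (J : ℕ) (es : List ℕ) (s : State) (T : ℕ) (ε : ℝ) : Prop where
  le : J ≤ L + 1
  r7 : s.reg 7 = threshold J
  progress : Progress D n L α sv out₀ es s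
  sparse : 0 < J → (uncovered (covers D α sv) n sv es).length ≤ 12 * K * threshold J
  edges : es.length + J * (192 * K) ≤ E
  time : J * phaseTime n L K + 1 + T₁ ≤ T
  error : β + J * ((192 * K + 1) * sampleError n L) ≤ ε
  good : ((0 < J → ∀ u < n,
      (uncovered (covers D α sv) n sv es).countP (covers D α sv u) < 2 * threshold J) ∧
    (J = 0 → uncovered (covers D α sv) n sv es = [])) ∨
      β + J * ((192 * K + 1) * sampleError n L) + 1 ≤ ε

/-- The certificate of this phase serves twice: it limits the edges of the phase, and after halving
`τ` it becomes `|U| ≤ 12 * K * τ`, which limits the samples of the next phase to `3072 * L * K`. The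
time is `T + 1` in the invariant because the test of the enclosing loop has already used one step.
-/
theorem wp_phase (hb : WordBounds n L W) {E T₁ J : ℕ} {β : ℝ} (hβ : 0 ≤ β) {Cv : List ℕ}
    (hcov : IsCover (covers D α sv) n sv Cv) (hK : 1 ≤ Cv.length)
    (hself : ∀ t < n, t ≠ sv → covers D α sv t t = true)
    (hI : PhaseInv D n L α sv Cv.length E T₁ β out₀ (J + 1) es s (T + 1) ε)
    (h : ∀ J' es' s' T' ε', PhaseInv D n L α sv Cv.length E T₁ β out₀ J' es' s' T' ε' →
      Post s' T' ε') :
    phaseCmd.wp W D G Post s T ε := by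
  set K := Cv.length with hKdef
  set δ := sampleError n L with hδdef
  have hδ : 0 ≤ δ := sampleError_nonneg n L
  set τ := threshold (J + 1) with hτdef
  have hτ : 0 < τ := by simp [hτdef, threshold]
  have hτW : τ < W := by
    refine lt_of_le_of_lt ?_ hb.pow
    exact Nat.pow_le_pow_right (by norm_num) (by have := hI.le; omega)
  have hp := hI.progress
  have htime := hI.time
  have herr := hI.error
  have hgood := hI.good
  have hsparse := hI.sparse (Nat.succ_pos J)
  have hedges := hI.edges
  have hLJ := hI.le
  rw [← hδdef] at herr hgood
  push_cast at herr hgood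
  have hm := hb.memory
  have htwo := hb.two_le
  have hM : 256 * L * ((uncovered (covers D α sv) n sv es).length / τ) ≤ 3072 * L * K := by
    calc 256 * L * ((uncovered (covers D α sv) n sv es).length / τ)
        ≤ 256 * L * (12 * K) := by
          gcongr
          exact Nat.div_le_of_le_mul (by rw [mul_comm]; exact hsparse)
      _ = 3072 * L * K := by ring
  rw [add_mul, one_mul] at htime
  have hPT : phaseTime n L K = 10 * (3072 * L * K) + 40 + n * (16 * (3072 * L * K) + 12) +
    n * (16 * (3072 * L * K) + 11) + 192 * K * (18 * n + 10 * (3072 * L * K) + 24) := rfl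
  set M := 3072 * L * K with hMdef
  have hKδ : 0 ≤ (K : ℝ) * δ := by positivity
  have hJδ : 0 ≤ (J : ℝ) * ((192 * K + 1) * δ) := by positivity
  refine Cmd.wp_seq (by omega) (wp_sample hb hp hI.r7 hτ hM (by omega)
    (by rw [← hδdef]; nlinarith) ?_)
  intro s₁ ρ ε₁ hF₁ hp₁ hρ₁ hε₁ hgood₁
  rw [← hδdef] at hε₁ hgood₁
  have e7 : s₁.reg 7 = τ := (hF₁.1 7 (by decide)).trans hI.r7
  refine Cmd.wp_seq (by omega) (Cmd.wp_exec rfl (by simp [Cmd.cost]; omega) ?_)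
  have hF₂ : Frame [8] s₁ ((Cmd.const 8 0).exec W D s₁) := by
    refine ⟨fun r hr => ?_, rfl⟩
    simp at hr
    simp [Cmd.exec, hr]
  have hρM : ρ.length ≤ M := hρ₁.len ▸ hM
  refine Cmd.wp_seq (by simp [Cmd.cost]; omega) (wp_certLoop (τ := τ) (M := M) (ρ := ρ) hb
    (hp₁.frame hF₂ hp₁.mem rfl) ((hF₂.1 7 (by decide)).trans e7) (by simp [Cmd.exec])
    ⟨(hF₂.1 9 (by decide)).trans hρ₁.r9, hρ₁.mem, hρ₁.len, hρ₁.sub⟩ hρM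
    (by simp [Cmd.cost]; omega) ?_)
  intro s₃ hp₃ hρ₃ f8 hcert
  have hfinal : ∀ s₅ T₅ ε₅, 3 ≤ T₅ → s₅.reg 7 ≤ τ → (∀ s₆, Frame [7, 17] s₅ s₆ → s₆.mem = s₅.mem →
      s₆.out = s₅.out → s₆.reg 7 = s₅.reg 7 / 2 → Post s₆ (T₅ - 3) ε₅) →
      (Cmd.block [.const 17 2, .arith .div 7 7 17]).wp W D G Post s₅ T₅ ε₅ := by
    intro s₅ T₅ ε₅ hT₅ hle₅ h₅
    refine Cmd.wp_exec rfl hT₅ (h₅ _ ⟨fun r hr => ?_, rfl⟩ rfl rfl ?_)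
    · simp at hr
      simp [Cmd.block, Cmd.exec, hr]
    · have d1 : 2 % W = 2 := Nat.mod_eq_of_lt (by have := hb.scale; omega)
      have d2 : s₅.reg 7 / 2 % W = s₅.reg 7 / 2 := Nat.mod_eq_of_lt (by omega)
      simp [Cmd.block, Cmd.exec, ArithOp.eval, d1, d2]
  -- Giving up means jumping to `J = 0`: a zero threshold stays zero under halving and ends the loop
  -- over phases. Completeness is waived by the surplus in the error budget.
  have hgiveUp : ∀ s₅ es₅ T₅ ε₅, Progress D n L α sv out₀ es₅ s₅ → es₅.length ≤ E →
      T₁ + 4 ≤ T₅ → s₅.reg 7 = 0 → β + 1 ≤ ε₅ →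
      (Cmd.block [.const 17 2, .arith .div 7 7 17]).wp W D G Post s₅ T₅ ε₅ := by
    intro s₅ es₅ T₅ ε₅ hp₅ hE hT₅ h7 hε₅
    refine hfinal s₅ T₅ ε₅ (by omega) (by omega) fun s₆ hF₆ hm₆ ho₆ h7' => ?_
    refine h 0 es₅ s₆ _ ε₅ ⟨by omega, by rw [h7', h7]; rfl,
      hp₅.frame hF₆ (hm₆ ▸ hp₅.mem) ho₆, by simp, by omega, by omega, ?_, ?_⟩
    · simp; linarith
    · right; simpa using hε₅
  refine Cmd.wp_seq (by simp [Cmd.cost]; omega) ?_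
  rcases hcert with ⟨f7, hcert⟩ | ⟨f7, u, hu, hbig⟩
  · have g0 : 0 < s₃.reg 7 := f7 ▸ hτ
    have hbr : s₃.reg 2 < s₃.reg 7 := by rw [hp₃.env.r2]; exact g0
    refine Cmd.wp_exec rfl (by simp [Cmd.cost]; omega) ?_
    have hF₄ : Frame [8] s₃ ((Cmd.ite 2 7 (.const 8 0) (.const 19 0)).exec W D s₃) := by
      refine ⟨fun r hr => ?_, by simp [Cmd.exec, hbr]⟩
      simp at hr
      simp [Cmd.exec, hr, hbr]
    have hm₄ : ((Cmd.ite 2 7 (.const 8 0) (.const 19 0)).exec W D s₃).mem = s₃.mem := by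
      simp [Cmd.exec, hbr]
    have hlt := length_uncovered_lt hcov hτ hb.pos hK
      (fun t ht => ⟨(mem_uncovered.1 ht).1, (mem_uncovered.1 ht).2.1⟩) hρ₁.len hρ₁.sub hcert
    rw [← hKdef] at hlt
    rw [add_mul, one_mul] at hedges
    refine Cmd.wp_seq (by simp [Cmd.cost]; omega) (wp_passLoop (τ := τ) (M := M)
      (E := E - J * (192 * K)) (T₁ := J * phaseTime n L K + 1 + T₁ + 3)
      (β := β + J * ((192 * K + 1) * δ)) (b₀ := 192 * K) (es₀ := es) (ρ₀ := ρ) (out₀ := out₀)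
      (sv := sv) (α := α) hb hτ (by linarith) ?_ ?_)
    · refine ⟨by omega, by simp [Cmd.exec, hbr], (hF₄.1 7 (by decide)).trans f7,
        hp₃.frame hF₄ (hm₄ ▸ hp₃.mem) (by simp [Cmd.exec, hbr]),
        ⟨(hF₄.1 9 (by decide)).trans hρ₃.r9, hm₄ ▸ hρ₃.mem, hρ₃.len, hρ₃.sub⟩, hM, ?_, by omega,
        ?_, ?_, ?_⟩
      · calc _ < 32 * (6 * K * τ) := by omega
          _ = 192 * K * τ := by ring
      · simp [Cmd.cost]; omega
      · rw [← hδdef]; push_cast; linarith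
      · rw [← hδdef]
        push_cast
        rcases hgood with hg | hg
        · exact hgood₁.imp (fun hg₁ => ⟨hg₁, by simp⟩) fun hg₁ => by linarith
        · right; linarith
    · rintro s₅ es₅ T₅ ε₅ hp₅ hE hT₅ (⟨h7, hβ₅, hle₅, hg₅⟩ | ⟨h7, hβ₅⟩)
      · refine hfinal s₅ T₅ ε₅ (by omega) (by omega) fun s₆ hF₆ hm₆ ho₆ h7' => ?_
        refine h J es₅ s₆ _ ε₅ ⟨by omega, ?_, hp₅.frame hF₆ (hm₆ ▸ hp₅.mem) ho₆, ?_, by omega,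
          by omega, hβ₅, ?_⟩
        · rw [h7', h7, hτdef, threshold_div_two]
        · intro hJ
          obtain ⟨J, rfl⟩ := Nat.exists_eq_add_of_le' hJ
          have : τ = 2 * threshold (J + 1) := by simp [hτdef, threshold, pow_succ, mul_comm]
          refine hle₅.trans (hlt.le.trans (le_of_eq ?_))
          rw [this]
          ring
        · refine hg₅.imp_left fun hg => ⟨fun hJ u hu => ?_, fun hJ => ?_⟩
          · obtain ⟨J, rfl⟩ := Nat.exists_eq_add_of_le' hJ
            have : τ = 2 * threshold (J + 1) := by simp [hτdef, threshold, pow_succ, mul_comm]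
            rw [← this]
            exact hg u hu
          · rw [List.eq_nil_iff_forall_not_mem]
            intro t ht
            -- In the last phase, counts below 1 are zero, whereas an uncovered target would cover
            -- itself.
            have hτ1 : τ = 1 := by simp [hτdef, threshold, hJ]
            obtain ⟨ht1, ht2, -⟩ := mem_uncovered.1 ht
            have h1 := hg t ht1
            rw [hτ1, Nat.lt_one_iff, List.countP_eq_zero] at h1
            exact h1 t ht (hself t ht1 ht2)
      · exact hgiveUp s₅ es₅ T₅ ε₅ hp₅ (by omega) (by omega) h7 (by linarith)
  · have hbr : ¬ s₃.reg 2 < s₃.reg 7 := by omega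
    refine Cmd.wp_exec rfl (by simp [Cmd.cost]; omega) ?_
    have hF₄ : Frame [19] s₃ ((Cmd.ite 2 7 (.const 8 0) (.const 19 0)).exec W D s₃) := by
      refine ⟨fun r hr => ?_, by simp [Cmd.exec, hbr]⟩
      simp at hr
      simp [Cmd.exec, hr, hbr]
    have hm₄ : ((Cmd.ite 2 7 (.const 8 0) (.const 19 0)).exec W D s₃).mem = s₃.mem := by
      simp [Cmd.exec, hbr]
    -- After a failed certification the candidate counter is left at `n`, so the second loop is
    -- skipped.
    refine Cmd.wp_seq (by simp [Cmd.cost]; omega) (Cmd.wp_loop_of_le (by simp [Cmd.cost]; omega)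
      ?_ ?_)
    · rw [hF₄.1 0 (by decide), hF₄.1 8 (by decide), f8, hp₃.env.r0]
    · refine hgiveUp _ es _ _ (hp₃.frame hF₄ (hm₄ ▸ hp₃.mem) (by simp [Cmd.exec, hbr])) (by omega)
        (by simp [Cmd.cost]; omega) ((hF₄.1 7 (by decide)).trans f7) ?_
      rcases hgood with hg | hg
      · rcases hgood₁ with hg₁ | hg₁
        -- All counts were below `2 * τ` at the start of the phase, so a good sample has no point
        -- with more than `1040 * L` hits.
        · have := (hg₁ u hu).1 (hg.1 (Nat.succ_pos J) u hu)
          omega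
        · linarith
      · linarith

end

/-! ### One source, all sources, the whole program -/

section

variable {W : ℕ} {D : ℕ → ℕ → ℝ} {G : State → Prop} {Post : Assertion} {s : State} {T : ℕ} {ε : ℝ}
variable {n L : ℕ} {α : ℝ} {sv : ℕ}

/-- The time for one source. -/
def sourceTime (n L K : ℕ) : ℕ := (L + 1) * phaseTime n L K + 12 * n + 20

/-- The error budget for one source. -/
noncomputable def sourceError (n L K : ℕ) : ℝ :=
  (L + 1 : ℕ) * ((192 * K + 1) * sampleError n L)

/-- The first threshold is `2 ^ L > n`, so the invariant on the counts and on the size of `U` holds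
trivially at the start. -/
theorem wp_source (hb : WordBounds n L W) {T₁ : ℕ} {β : ℝ} (hβ : 0 ≤ β) {Cv : List ℕ}
    (hcov : IsCover (covers D α sv) n sv Cv) (hK : 1 ≤ Cv.length)
    (hself : ∀ t < n, t ≠ sv → covers D α sv t t = true)
    (henv : Env n L α s) (h5 : s.reg 5 = sv)
    (hT : sourceTime n L Cv.length + T₁ ≤ T) (hε : β + sourceError n L Cv.length ≤ ε)
    (h : ∀ s' es T' ε', Progress D n L α sv s.out es s' →
      es.length ≤ (L + 1) * (192 * Cv.length) → T₁ ≤ T' → β ≤ ε' →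
      (uncovered (covers D α sv) n sv es = [] ∨ β + 1 ≤ ε') → Post s' T' ε') :
    sourceCmd.wp W D G Post s T ε := by
  have hm := hb.memory
  rw [sourceTime] at hT
  refine Cmd.wp_seq (by omega) (wp_initLoop (by omega) henv.r0 henv.r1 (by omega) ?_)
  intro s₁ hF₁ hm₁ ho₁ h6
  have hl : uncovered (covers D α sv) n sv [] = (List.range n).filter fun t => t ≠ s.reg 5 := by
    simp [uncovered, h5]
  rw [← hl] at hm₁ h6
  have hp₁ : Progress D n L α sv s.out [] s₁ :=
    ⟨henv.frame hF₁, (hF₁.1 5 (by decide)).trans h5, h6, hm₁, ho₁, by simp⟩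
  refine Cmd.wp_seq (by omega) (Cmd.wp_exec rfl (by simp [Cmd.cost]; omega) ?_)
  have hF₂ : Frame [7] s₁ ((Cmd.arith .add 7 4 2).exec W D s₁) := by
    refine ⟨fun r hr => ?_, rfl⟩
    simp at hr
    simp [Cmd.exec, hr]
  have hpow : 2 ^ L % W = 2 ^ L := Nat.mod_eq_of_lt
    (lt_of_le_of_lt (Nat.pow_le_pow_right (by norm_num) (Nat.le_succ L)) hb.pow)
  have hlen := length_uncovered_le (covers D α sv) n sv []
  have hlt := hb.lt_pow
  refine Cmd.wp_loop (fun s' T' ε' => ∃ J es, PhaseInv D n L α sv Cv.length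
    ((L + 1) * (192 * Cv.length)) T₁ β s.out J es s' T' ε') ⟨L + 1, [], le_rfl, ?_,
      hp₁.frame hF₂ hp₁.mem rfl, fun _ => ?_, by simp, ?_, hε,
      Or.inl ⟨fun _ u _ => ?_, by simp⟩⟩ ?_
  · simp [Cmd.exec, ArithOp.eval, hp₁.env.r4, hp₁.env.r2, hpow, threshold]
  · calc _ ≤ 1 * 2 ^ L := by omega
      _ ≤ _ := Nat.mul_le_mul_right _ (by omega)
  · simp [Cmd.cost]; omega
  · have h1 := List.countP_le_length (p := covers D α sv u)
      (l := uncovered (covers D α sv) n sv [])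
    simp only [threshold]
    omega
  · rintro s' T' ε' ⟨J, es, hI⟩
    have htime := hI.time
    refine ⟨by omega, fun hlt => ?_, fun hle => ?_⟩
    · rw [hI.progress.env.r2, hI.r7] at hlt
      obtain ⟨J, rfl⟩ : ∃ J', J = J' + 1 := by
        cases J with
        | zero => exact absurd hlt (lt_irrefl 0)
        | succ J => exact ⟨J, rfl⟩
      refine wp_phase hb hβ hcov hK hself (E := (L + 1) * (192 * Cv.length)) (T₁ := T₁) (J := J)
        (es := es) (out₀ := s.out) ?_ fun J' es' s' T' ε' hI' => ⟨J', es', hI'⟩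
      rw [Nat.sub_add_cancel (by omega)]
      exact hI
    · rw [hI.progress.env.r2, hI.r7] at hle
      obtain rfl : J = 0 := by
        cases J with
        | zero => rfl
        | succ J => simp [threshold] at hle
      have herr := hI.error
      have hgood := hI.good
      simp only [Nat.cast_zero, zero_mul, add_zero] at herr hgood
      refine h s' es _ ε' hI.progress (by have := hI.edges; omega) (by omega) herr ?_
      exact hgood.imp_left fun hg => hg.2 trivial

/-- The output for the sources below `i` is complete. -/
def Complete (D : ℕ → ℕ → ℝ) (n : ℕ) (α : ℝ) (i : ℕ) (out : List (ℕ × ℕ)) : Prop :=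
  ∀ v < i, ∀ t < n, t ≠ v → ∃ u, (v, u) ∈ out ∧ covers D α v u t = true

/-- The number of edges in the output with source `v`. -/
def edgeCount (v : ℕ) (out : List (ℕ × ℕ)) : ℕ := out.countP fun e => e.1 = v

/-- The output for the sources below `i` is in range and has at most `E v` edges from `v`. -/
structure Sparse (n : ℕ) (E : ℕ → ℕ) (i : ℕ) (out : List (ℕ × ℕ)) : Prop where
  lt : ∀ e ∈ out, e.1 < i ∧ e.2 < n
  count : ∀ v < i, edgeCount v out ≤ E v

theorem edgeCount_append_self (v : ℕ) (es : List ℕ) (out : List (ℕ × ℕ))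
    (h : ∀ e ∈ out, e.1 < v) : edgeCount v (es.map (fun u => (v, u)) ++ out) = es.length := by
  have h0 : out.countP (fun e => decide (e.1 = v)) = 0 := by
    rw [List.countP_eq_zero]
    intro e he
    have := h e he
    simp
    omega
  rw [edgeCount, List.countP_append, h0, List.countP_map, add_zero, List.countP_eq_length]
  simp

theorem edgeCount_append_of_ne {v w : ℕ} (hvw : w ≠ v) (es : List ℕ) (out : List (ℕ × ℕ)) :
    edgeCount v (es.map (fun u => (w, u)) ++ out) = edgeCount v out := by
  have h0 : (es.map fun u => (w, u)).countP (fun e => decide (e.1 = v)) = 0 := by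
    rw [List.countP_eq_zero]
    intro e he
    obtain ⟨u, -, rfl⟩ := List.mem_map.1 he
    simpa using hvw
  rw [edgeCount, List.countP_append, h0, zero_add, edgeCount]

theorem sourceError_nonneg (n L K : ℕ) : 0 ≤ sourceError n L K := by
  have := sampleError_nonneg n L
  unfold sourceError
  positivity

theorem wp_sourceLoop (hb : WordBounds n L W) {K : ℕ → ℕ}
    (hK : ∀ v < n, 1 ≤ K v ∧ ∃ Cv : List ℕ, Cv.length = K v ∧ IsCover (covers D α v) n v Cv)
    (hself : ∀ v < n, ∀ t < n, t ≠ v → covers D α v t t = true)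
    (henv : Env n L α s) (h5 : s.reg 5 = 0) (hout : s.out = [])
    (hT : ∑ v ∈ Finset.Ico 0 n, (sourceTime n L (K v) + 4) + 1 ≤ T)
    (hε : ∑ v ∈ Finset.Ico 0 n, sourceError n L (K v) ≤ ε)
    (h : ∀ s' T' ε', Sparse n (fun v => (L + 1) * (192 * K v)) n s'.out →
      (Complete D n α n s'.out ∨ 1 ≤ ε') → Post s' T' ε') :
    (Cmd.loop 5 0 (.seq sourceCmd (.arith .add 5 5 1))).wp W D G Post s T ε := by
  have hm := hb.memory
  refine Cmd.wp_loop (fun s' T' ε' => ∃ i ≤ n, Env n L α s' ∧ s'.reg 5 = i ∧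
    Sparse n (fun v => (L + 1) * (192 * K v)) i s'.out ∧
    ∑ v ∈ Finset.Ico i n, (sourceTime n L (K v) + 4) + 1 ≤ T' ∧
    ∑ v ∈ Finset.Ico i n, sourceError n L (K v) ≤ ε' ∧
    (Complete D n α i s'.out ∨ ∑ v ∈ Finset.Ico i n, sourceError n L (K v) + 1 ≤ ε')) ?_ ?_
  · refine ⟨0, by omega, henv, h5, ⟨by simp [hout], by simp⟩, hT, hε, Or.inl ?_⟩
    intro v hv
    omega
  · rintro s' T' ε' ⟨i, hi, henv, h5, hs, htime, herr, hgood⟩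
    refine ⟨by omega, fun hlt => ?_, fun hle => ?_⟩
    · rw [h5, henv.r0] at hlt
      rw [Finset.sum_eq_sum_Ico_succ_bot hlt] at htime herr hgood
      obtain ⟨hK1, Cv, hCv, hcov⟩ := hK i hlt
      have hβ : 0 ≤ ∑ v ∈ Finset.Ico (i + 1) n, sourceError n L (K v) :=
        Finset.sum_nonneg fun v _ => sourceError_nonneg n L (K v)
      set R := ∑ v ∈ Finset.Ico (i + 1) n, sourceError n L (K v) with hR
      set R' := ∑ v ∈ Finset.Ico (i + 1) n, (sourceTime n L (K v) + 4) with hR'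
      -- Everything beyond the share of this source is reserved, not merely `R`: after an earlier
      -- failure, the surplus 1 must survive.
      obtain ⟨β, hβR, hβε, hgood'⟩ : ∃ β, R ≤ β ∧ β + sourceError n L (K i) ≤ ε' ∧
          (Complete D n α i s'.out ∨ R + 1 ≤ β) := by
        refine ⟨ε' - sourceError n L (K i), by linarith, by linarith, ?_⟩
        exact hgood.imp_right fun hg => by linarith
      refine Cmd.wp_seq (by omega) (wp_source hb (T₁ := R' + 2) (hβ.trans hβR) hcov (by omega)
        (hself i hlt) henv h5 (by rw [hCv]; omega) (by rw [hCv]; exact hβε) ?_)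
      rw [hCv]
      intro s₁ es T₁ ε₁ hp₁ hes hT₁ hε₁ hgood₁
      refine Cmd.wp_exec rfl (by simp [Cmd.cost]; omega) ?_
      have c1 : (i + 1) % W = i + 1 := Nat.mod_eq_of_lt (by omega)
      have hF₂ : Frame [5] s₁ ((Cmd.arith .add 5 5 1).exec W D s₁) := by
        refine ⟨fun r hr => ?_, rfl⟩
        simp at hr
        simp [Cmd.exec, hr]
      have hout : ((Cmd.arith .add 5 5 1).exec W D s₁).out =
          es.map (fun u => (i, u)) ++ s'.out := hp₁.out
      refine ⟨i + 1, hlt, hp₁.env.frame hF₂, ?_, ?_, ?_, ?_, ?_⟩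
      · simp [Cmd.exec, ArithOp.eval, hp₁.r5, hp₁.env.r1, c1]
      · rw [hout]
        refine ⟨fun e he => ?_, fun v hv => ?_⟩
        · rcases List.mem_append.1 he with he | he
          · obtain ⟨u, hu, rfl⟩ := List.mem_map.1 he
            exact ⟨Nat.lt_succ_self i, hp₁.lt u hu⟩
          · have := hs.lt e he
            exact ⟨by omega, this.2⟩
        · rcases Nat.lt_succ_iff_lt_or_eq.1 hv with hv | rfl
          · rw [edgeCount_append_of_ne (by omega)]
            exact hs.count v hv
          · rw [edgeCount_append_self _ _ _ fun e he => (hs.lt e he).1]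
            exact hes
      · simp [Cmd.cost]; omega
      · linarith
      · rcases hgood' with hg | hg
        · refine hgood₁.imp (fun hg₁ => ?_) fun hg₁ => by linarith
          rw [hout]
          intro v hv t ht htv
          rcases Nat.lt_succ_iff_lt_or_eq.1 hv with hv | rfl
          · obtain ⟨u, hu, hc⟩ := hg v hv t ht htv
            exact ⟨u, List.mem_append_right _ hu, hc⟩
          · have hnot : t ∉ uncovered (covers D α v) n v es := by simp [hg₁]
            rw [mem_uncovered] at hnot
            push Not at hnot
            obtain ⟨u, hu, hc⟩ := hnot ht htv
            exact ⟨u, List.mem_append_left _ (List.mem_map_of_mem hu), by simpa using hc⟩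
        · right; linarith
    · rw [h5, henv.r0] at hle
      obtain rfl : i = n := by omega
      simp only [Finset.Ico_self, Finset.sum_empty, zero_add] at hgood
      exact h s' _ ε' hs hgood

/-- The total time. -/
def totalTime (n L : ℕ) (K : ℕ → ℕ) : ℕ :=
  ∑ v ∈ Finset.Ico 0 n, (sourceTime n L (K v) + 4) + 4 * L + 40

theorem navCmd_within (hb : WordBounds n n.size W) {K : ℕ → ℕ}
    (hK : ∀ v < n, 1 ≤ K v ∧ ∃ Cv : List ℕ, Cv.length = K v ∧ IsCover (covers D α v) n v Cv)
    (hself : ∀ v < n, ∀ t < n, t ≠ v → covers D α v t t = true) :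
    Within W D (fun s => Sparse n (fun v => (n.size + 1) * (192 * K v)) n s.out ∧
      Complete D n α n s.out) ([navCmd], startState W n α) (totalTime n n.size K)
      (∑ v ∈ Finset.Ico 0 n, sourceError n n.size (K v)) := by
  have hm := hb.memory
  have hsc := hb.scale
  have hc := hb.const
  have htwo := hb.two_le
  set S := ∑ v ∈ Finset.Ico 0 n, (sourceTime n n.size (K v) + 4) with hS
  set L := n.size with hL
  suffices hwp : navCmd.wp W D (fun s => Sparse n (fun v => (L + 1) * (192 * K v)) n s.out ∧
      Complete D n α n s.out) (fun s' _ ε' =>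
        Sparse n (fun v => (L + 1) * (192 * K v)) n s'.out ∧
          (Complete D n α n s'.out ∨ 1 ≤ ε')) (startState W n α) (totalTime n L K)
      (∑ v ∈ Finset.Ico 0 n, sourceError n L (K v)) by
    refine hwp [] fun s' T' ε' _ hp => within_nil ?_
    exact hp.2.imp_left fun hg => ⟨hp.1, hg⟩
  have e1 : 1 % W = 1 := Nat.mod_eq_of_lt (by omega)
  have en : n % W = n := Nat.mod_eq_of_lt (by omega)
  have en1 : (n + 1) % W = n + 1 := Nat.mod_eq_of_lt (by omega)
  rw [totalTime, ← hS]
  clear_value S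
  refine Cmd.wp_seq (by omega) (Cmd.wp_exec rfl (by simp [Cmd.cost, Cmd.block]) ?_)
  refine Cmd.wp_seq (by simp [Cmd.cost, Cmd.block]) ?_
  refine Cmd.wp_loop (fun s' T' ε' => ∃ j ≤ L, s'.reg 0 = n ∧ s'.reg 1 = 1 ∧ s'.reg 2 = 0 ∧
    s'.reg 3 = j ∧ s'.reg 4 = 2 ^ j ∧ s'.reg 16 = n + 1 ∧ s'.real 0 = α ∧ s'.out = [] ∧
    S + 25 + 4 * (L - j) ≤ T' ∧ ε' = ∑ v ∈ Finset.Ico 0 n, sourceError n L (K v)) ?_ ?_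
  · refine ⟨0, by omega, ?_⟩
    simp [Cmd.exec, Cmd.cost, Cmd.block, ArithOp.eval, startState, Function.update_apply, e1, en,
      en1]
    omega
  · rintro s' T' ε' ⟨j, hj, h0, h1, h2, h3, h4, h16, hα, hout, htime, rfl⟩
    refine ⟨by omega, fun hlt => ?_, fun hle => ?_⟩
    · rw [h4, h16] at hlt
      -- The loop doubles while `2 ^ j ≤ n`, so it stops exactly at `j = n.size`.
      have hjL : j < L := Nat.lt_size.2 (by omega)
      have c1 : (j + 1) % W = j + 1 := Nat.mod_eq_of_lt (by omega)
      have c2 : (2 ^ j + 2 ^ j) % W = 2 ^ (j + 1) := by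
        rw [← two_mul, ← pow_succ']
        exact Nat.mod_eq_of_lt (lt_of_le_of_lt
          (Nat.pow_le_pow_right (by norm_num) (by omega)) hb.pow)
      refine Cmd.wp_exec rfl (by simp [Cmd.cost]; omega) ⟨j + 1, hjL, ?_⟩
      simp [Cmd.exec, Cmd.cost, ArithOp.eval, h0, h1, h2, h3, h4, h16, hα, hout, c1, c2]
      omega
    · rw [h4, h16] at hle
      obtain rfl : j = L := le_antisymm hj (Nat.size_le.2 (by omega))
      have c1 : 256 % W = 256 := Nat.mod_eq_of_lt (by omega)
      have c2 : 32 % W = 32 := Nat.mod_eq_of_lt (by omega)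
      have c3 : 1040 % W = 1040 := Nat.mod_eq_of_lt (by omega)
      have c4 : (256 * L) % W = 256 * L := Nat.mod_eq_of_lt (by omega)
      have c5 : (32 * L) % W = 32 * L := Nat.mod_eq_of_lt (by omega)
      have c6 : (1040 * L) % W = 1040 * L := Nat.mod_eq_of_lt (by omega)
      refine Cmd.wp_seq (by omega) (Cmd.wp_exec rfl (by simp [Cmd.cost, Cmd.block]; omega) ?_)
      refine wp_sourceLoop hb hK hself ?_ ?_ ?_ ?_ le_rfl fun s' T' ε' hs hg => ⟨hs, hg⟩
      · constructor <;> simp [Cmd.exec, Cmd.block, ArithOp.eval, h0, h1, h2, h3, h4, hα, c1, c2,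
          c3, c4, c5, c6]
      · simp [Cmd.exec, Cmd.block]
      · simp [Cmd.exec, Cmd.block, hout]
      · rw [← hS]
        simp [Cmd.cost, Cmd.block]; omega

end

/-! ### Numerical estimates -/

theorem wordBounds_size {n : ℕ} (hn : 2 ≤ n) : WordBounds n n.size (2 ^ (20 * n.size)) := by
  have h2 : 2 ≤ n.size := Nat.lt_size.2 (by simpa using hn)
  have hlt : n < 2 ^ n.size := Nat.lt_size_self n
  have hL : n.size < 2 ^ n.size := Nat.lt_two_pow_self
  set L := n.size with hLdef
  have key : ∀ a, a < 20 * L → 2 ^ a < 2 ^ (20 * L) := fun a ha =>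
    Nat.pow_lt_pow_right (by norm_num) ha
  refine ⟨hn, by omega, hlt, ?_, ?_, key _ (by omega), ?_⟩
  · calc n + 256 * L * n ≤ 2 ^ 9 * 2 ^ L * 2 ^ L := by nlinarith
      _ = 2 ^ (9 + L + L) := by rw [pow_add, pow_add]
      _ < _ := key _ (by omega)
  · calc 1040 * L ≤ 2 ^ 11 * 2 ^ L := by omega
      _ = 2 ^ (11 + L) := by rw [pow_add]
      _ < _ := key _ (by omega)
  · calc 2000 * n ≤ 2 ^ 11 * 2 ^ L := by omega
      _ = 2 ^ (11 + L) := by rw [pow_add]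
      _ < _ := key _ (by omega)

/-- With `n.size = m + 1` and `m ≥ 1`, one has `m + 2 ≤ 3 * m` and `2 ^ m ≤ n`, while `5 * log 2 >
3`. -/
theorem size_add_one_le_log {n : ℕ} (hn : 2 ≤ n) : ((n.size + 1 : ℕ) : ℝ) ≤ 5 * Real.log n := by
  have h2 : 2 ≤ n.size := Nat.lt_size.2 (by simpa using hn)
  obtain ⟨m, hm⟩ : ∃ m, n.size = m + 1 := ⟨n.size - 1, by omega⟩
  have hpow : 2 ^ m ≤ n := Nat.lt_size.1 (by omega)
  have hlog : (m : ℝ) * Real.log 2 ≤ Real.log n := by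
    rw [← Real.log_pow]
    exact Real.log_le_log (by positivity) (by exact_mod_cast hpow)
  have hm1 : (1 : ℝ) ≤ m := by exact_mod_cast (by omega : 1 ≤ m)
  have := Real.log_two_gt_d9
  rw [hm]
  push_cast
  nlinarith

theorem sum_sourceError_le {n : ℕ} (hn : 2 ≤ n) {K : ℕ → ℕ} (hK : ∀ v < n, K v ≤ n) :
    ∑ v ∈ Finset.Ico 0 n, sourceError n n.size (K v) ≤ 1 / n := by
  have h2 : 2 ≤ n.size := Nat.lt_size.2 (by simpa using hn)
  have hlt : n < 2 ^ n.size := Nat.lt_size_self n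
  have hL : n.size + 1 ≤ 2 ^ n.size := Nat.lt_two_pow_self
  set L := n.size with hLdef
  have hn0 : (0 : ℝ) < n := by exact_mod_cast (by omega : 0 < n)
  -- There are `n` sources, `L + 1` phases and at most `193 * n` samples per phase, each with error
  -- `3 * n * 2 ^ (-16 * L)`; the fourth factor `n` comes from the target `1 / n`.
  have hnat : 579 * n ^ 4 * (L + 1) ≤ 2 ^ (16 * L) := by
    calc 579 * n ^ 4 * (L + 1) ≤ 2 ^ 10 * (2 ^ L) ^ 4 * 2 ^ L := by
          gcongr
          norm_num
      _ = 2 ^ (10 + L * 4 + L) := by rw [pow_add, pow_add, pow_mul]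
      _ ≤ 2 ^ (16 * L) := Nat.pow_le_pow_right (by norm_num) (by omega)
  have hreal : 579 * (n : ℝ) ^ 4 * (L + 1) ≤ 2 ^ (16 * L) := by exact_mod_cast hnat
  have hterm : ∀ v ∈ Finset.Ico 0 n, sourceError n L (K v) ≤
      (L + 1) * ((193 * n) * (3 * n * (1 / 2) ^ (16 * L))) := by
    intro v hv
    have hKv : (K v : ℝ) ≤ n := by exact_mod_cast hK v (Finset.mem_Ico.1 hv).2
    have h1 : (1 : ℝ) ≤ n := by exact_mod_cast (by omega : 1 ≤ n)
    unfold sourceError sampleError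
    push_cast
    gcongr
    linarith
  refine (Finset.sum_le_card_nsmul _ _ _ hterm).trans ?_
  rw [Nat.card_Ico, Nat.sub_zero, nsmul_eq_mul, le_div_iff₀ hn0, one_div_pow]
  have hpos : (0 : ℝ) < 2 ^ (16 * L) := by positivity
  calc (n : ℝ) * ((L + 1) * ((193 * n) * (3 * n * (1 / 2 ^ (16 * L))))) * n
      = (579 * (n : ℝ) ^ 4 * (L + 1)) / 2 ^ (16 * L) := by ring
    _ ≤ 1 := (div_le_one hpos).2 hreal

/-- The redraws contribute a term of order `L * K ^ 2`, which is absorbed by `K ≤ n`. -/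
theorem phaseTime_le {n L K : ℕ} (hn : 1 ≤ n) (hL : 1 ≤ L) (hK : 1 ≤ K) (hKn : K ≤ n) :
    phaseTime n L K ≤ 7000000 * (n * L * K) := by
  have h1 : L * K ≤ n * L * K := by nlinarith [Nat.mul_le_mul hn (le_refl (L * K))]
  have h2 : 1 ≤ L * K := Nat.mul_pos hL hK
  have h3 : n ≤ n * L * K := by nlinarith [Nat.mul_le_mul (le_refl n) h2]
  have h4 : K * n ≤ n * L * K := by nlinarith [Nat.mul_le_mul (le_refl (n * K)) hL]
  have h5 : K * (L * K) ≤ n * L * K := by nlinarith [Nat.mul_le_mul hKn (le_refl (L * K))]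
  have h6 : K ≤ n * L * K := by nlinarith [Nat.mul_le_mul hL (le_refl K)]
  have e : phaseTime n L K = 30720 * (L * K) + 40 + 98304 * (n * L * K) + 23 * n +
      (3456 * (K * n) + 5898240 * (K * (L * K)) + 4608 * K) := by
    unfold phaseTime
    ring
  omega

theorem totalTime_le {n L : ℕ} {K : ℕ → ℕ} (hn : 1 ≤ n) (hL : 1 ≤ L)
    (hK : ∀ v < n, 1 ≤ K v ∧ K v ≤ n) :
    totalTime n L K ≤ 8000000 * (n * ∑ v ∈ Finset.range n, K v) * (L + 1) ^ 2 := by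
  have hterm : ∀ v ∈ Finset.Ico 0 n, sourceTime n L (K v) + 4 ≤
      7000036 * n * (L + 1) ^ 2 * K v := by
    intro v hv
    obtain ⟨h1, h2⟩ := hK v (Finset.mem_Ico.1 hv).2
    have hp := phaseTime_le hn hL h1 h2
    have hL1 : 1 ≤ (L + 1) ^ 2 := Nat.one_le_pow _ _ (by omega)
    have hnK : n ≤ n * (L + 1) ^ 2 * K v :=
      (Nat.le_mul_of_pos_right _ hL1).trans (Nat.le_mul_of_pos_right _ h1)
    have hmain : (L + 1) * phaseTime n L (K v) ≤ 7000000 * (n * (L + 1) ^ 2 * K v) := by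
      calc (L + 1) * phaseTime n L (K v) ≤ (L + 1) * (7000000 * (n * (L + 1) * K v)) := by
            gcongr
            exact hp.trans (by gcongr; omega)
        _ = 7000000 * (n * (L + 1) ^ 2 * K v) := by ring
    have : 7000036 * n * (L + 1) ^ 2 * K v = 7000036 * (n * (L + 1) ^ 2 * K v) := by ring
    rw [sourceTime, this]
    omega
  have hsum := Finset.sum_le_sum hterm
  rw [← Finset.mul_sum, ← Finset.range_eq_Ico] at hsum
  have hS : 1 ≤ ∑ v ∈ Finset.range n, K v :=
    (hK 0 (by omega)).1.trans (Finset.single_le_sum (f := K) (fun _ _ => Nat.zero_le _)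
      (Finset.mem_range.2 (by omega)))
  rw [totalTime, ← Finset.range_eq_Ico]
  set S := ∑ v ∈ Finset.range n, K v with hSdef
  set A := n * (L + 1) ^ 2 * S with hA
  have hLA : L + 1 ≤ A := by
    calc L + 1 ≤ (L + 1) ^ 2 := Nat.le_self_pow (by norm_num) _
      _ ≤ n * (L + 1) ^ 2 := Nat.le_mul_of_pos_left _ hn
      _ ≤ A := Nat.le_mul_of_pos_right _ hS
  have e1 : 7000036 * n * (L + 1) ^ 2 * S = 7000036 * A := by rw [hA]; ring
  have e2 : 8000000 * (n * S) * (L + 1) ^ 2 = 8000000 * A := by rw [hA]; ring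
  rw [e1] at hsum
  rw [e2]
  omega

/-! ### From the output to graphs -/

section

variable {P : Type*} {n : ℕ} (e : Fin n ≃ P)

theorem numEdges_eq_sum [Fintype P] (H : Digraph P) :
    numEdges H = ∑ v : Fin n, outDegree H (e v) := by
  have h : numEdges H = Nat.card (Σ a, {b // H.Adj a b}) :=
    Nat.card_congr (Equiv.subtypeProdEquivSigmaSubtype fun a b => H.Adj a b)
  rw [h, Nat.card_sigma, ← Equiv.sum_comp e]
  rfl

theorem outDegree_outputGraph_le (c : Config) (v : Fin n) :
    outDegree (outputGraph e c) (e v) ≤ edgeCount v c.2.out := by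
  classical
  have hinj : Function.Injective fun u : P => ((v : ℕ), (e.symm u : ℕ)) := by
    intro a b hab
    simpa [Fin.val_inj] using hab
  rw [outDegree, ← Set.ncard_image_of_injective _ hinj]
  have hsub : (fun u : P => ((v : ℕ), (e.symm u : ℕ))) '' {u | (outputGraph e c).Adj (e v) u} ⊆
      ((c.2.out.filter fun p => p.1 = (v : ℕ)).toFinset : Set (ℕ × ℕ)) := by
    rintro _ ⟨u, hu, rfl⟩
    simpa [outputGraph] using hu
  refine (Set.ncard_le_ncard hsub (Finset.finite_toSet _)).trans ?_
  rw [Set.ncard_coe_finset, edgeCount, List.countP_eq_length_filter]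
  exact List.toFinset_card_le _

end

/-! ### Minimum covers as lower bounds for navigable graphs -/

section

variable {P : Type*} [MetricSpace P] {n : ℕ} (e : Fin n ≃ P) {α : ℝ}

theorem oracle_apply (i j : Fin n) : oracle e i j = dist (e i) (e j) := by
  simp [oracle]

theorem covers_oracle_iff {s u t : Fin n} :
    covers (oracle e) α s u t = true ↔ dist (e u) (e t) < dist (e s) (e t) / α := by
  simp [covers, oracle_apply]

theorem covers_oracle_self (hα : 1 ≤ α) {v t : ℕ} (hv : v < n) (ht : t < n) (htv : t ≠ v) :
    covers (oracle e) α v t t = true := by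
  have h := covers_oracle_iff (α := α) e (s := ⟨v, hv⟩) (u := ⟨t, ht⟩) (t := ⟨t, ht⟩)
  refine h.2 ?_
  rw [dist_self]
  refine div_pos (dist_pos.2 fun heq => htv ?_) (by linarith)
  have := e.injective heq
  simpa using (Fin.mk.inj_iff.1 this).symm

/-- The minimum number of points that cover all targets other than `v`. -/
noncomputable def coverNumber (D : ℕ → ℕ → ℝ) (α : ℝ) (n v : ℕ) : ℕ :=
  sInf {k | ∃ Cv : List ℕ, Cv.length = k ∧ IsCover (covers D α v) n v Cv}

theorem coverNumber_le {D : ℕ → ℕ → ℝ} {v : ℕ} {Cv : List ℕ}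
    (h : IsCover (covers D α v) n v Cv) : coverNumber D α n v ≤ Cv.length :=
  Nat.sInf_le ⟨Cv, rfl, h⟩

theorem isCover_range (hα : 1 ≤ α) {v : ℕ} (hv : v < n) :
    IsCover (covers (oracle e) α v) n v (List.range n) :=
  ⟨fun _ hu => List.mem_range.1 hu, fun t ht htv =>
    ⟨t, List.mem_range.2 ht, covers_oracle_self e hα hv ht htv⟩⟩

theorem coverNumber_le_card (hα : 1 ≤ α) {v : ℕ} (hv : v < n) :
    coverNumber (oracle e) α n v ≤ n :=
  (coverNumber_le (isCover_range e hα hv)).trans (by simp)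

theorem exists_isCover (hα : 1 ≤ α) {v : ℕ} (hv : v < n) :
    ∃ Cv : List ℕ, Cv.length = coverNumber (oracle e) α n v ∧
      IsCover (covers (oracle e) α v) n v Cv :=
  Nat.sInf_mem (s := {k | ∃ Cv : List ℕ, Cv.length = k ∧ IsCover (covers (oracle e) α v) n v Cv})
    ⟨_, List.range n, rfl, isCover_range e hα hv⟩

theorem coverNumber_pos (hn : 2 ≤ n) (hα : 1 ≤ α) {v : ℕ} (hv : v < n) :
    1 ≤ coverNumber (oracle e) α n v := by
  obtain ⟨Cv, hlen, hcov⟩ := exists_isCover e hα hv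
  rw [← hlen, Nat.succ_le_iff, List.length_pos_iff_exists_mem]
  obtain ⟨t, ht, htv⟩ : ∃ t < n, t ≠ v := by
    rcases Nat.eq_zero_or_pos v with rfl | hpos
    · exact ⟨1, by omega, by omega⟩
    · exact ⟨0, by omega, by omega⟩
  obtain ⟨u, hu, -⟩ := hcov.2 t ht htv
  exact ⟨u, hu⟩

/-- The out-neighbours of a vertex in a navigable graph form a cover; this is the only lower bound
on the optimum that is used. -/
theorem coverNumber_le_outDegree [Fintype P] {H : Digraph P} (hH : Navigable α H) (v : Fin n) :
    coverNumber (oracle e) α n v ≤ outDegree H (e v) := by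
  have hfin : {u : P | H.Adj (e v) u}.Finite := Set.toFinite _
  have hcov : IsCover (covers (oracle e) α v) n v
      (hfin.toFinset.toList.map fun u => (e.symm u : ℕ)) := by
    refine ⟨fun u hu => ?_, fun t ht htv => ?_⟩
    · obtain ⟨p, -, rfl⟩ := List.mem_map.1 hu
      exact (e.symm p).2
    · obtain ⟨u, hu, hlt⟩ := hH (e v) (e ⟨t, ht⟩) (dist_pos.2 fun heq => htv (by
        rw [e.injective heq]))
      refine ⟨e.symm u, List.mem_map.2 ⟨u, by simpa using hu, rfl⟩, ?_⟩
      exact (covers_oracle_iff e (s := v) (u := e.symm u) (t := ⟨t, ht⟩)).2 (by simpa using hlt)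
  refine (coverNumber_le hcov).trans ?_
  rw [List.length_map, Finset.length_toList, outDegree, Set.ncard_eq_toFinset_card _ hfin]

theorem navigable_outputGraph {c : Config} (hlt : ∀ p ∈ c.2.out, p.1 < n ∧ p.2 < n)
    (hc : Complete (oracle e) n α n c.2.out) : Navigable α (outputGraph e c) := by
  intro s t hst
  have hne : ((e.symm t : Fin n) : ℕ) ≠ e.symm s := by
    intro heq
    rw [Fin.val_inj, e.symm.injective.eq_iff] at heq
    rw [heq, dist_self] at hst
    exact lt_irrefl _ hst
  obtain ⟨u, hu, hcov⟩ := hc (e.symm s) (e.symm s).2 (e.symm t) (e.symm t).2 hne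
  have hun : u < n := (hlt _ hu).2
  refine ⟨e ⟨u, hun⟩, by simpa [outputGraph] using hu, ?_⟩
  have := (covers_oracle_iff e (s := e.symm s) (u := ⟨u, hun⟩) (t := e.symm t)).1 hcov
  simpa using this

/-- A comparison at each vertex yields one objective by taking the maximum and the other by summing.
-/
theorem approx_of_outDegree_le [Fintype P] {G : Digraph P} {A : ℕ} {c : ℝ} (hA : (A : ℝ) ≤ c)
    (hG : Navigable α G)
    (hdeg : ∀ v : Fin n, outDegree G (e v) ≤ A * coverNumber (oracle e) α n v) :
    IsMaxDegApprox α c G ∧ IsSizeApprox α c G := by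
  refine ⟨⟨hG, fun H hH => ?_⟩, hG, fun H hH => ?_⟩
  · have h : maxOutDegree G ≤ A * maxOutDegree H := by
      refine Finset.sup_le fun s _ => ?_
      have h1 := hdeg (e.symm s)
      have h2 := coverNumber_le_outDegree e hH (e.symm s)
      rw [Equiv.apply_symm_apply] at h1 h2
      refine h1.trans (Nat.mul_le_mul_left _ (h2.trans ?_))
      exact Finset.le_sup (f := outDegree H) (Finset.mem_univ s)
    calc (maxOutDegree G : ℝ) ≤ A * maxOutDegree H := by exact_mod_cast h
      _ ≤ c * maxOutDegree H := by gcongr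
  · have h : numEdges G ≤ A * numEdges H := by
      rw [numEdges_eq_sum e, numEdges_eq_sum e, Finset.mul_sum]
      exact Finset.sum_le_sum fun v _ => (hdeg v).trans
        (Nat.mul_le_mul_left _ (coverNumber_le_outDegree e hH v))
    calc (numEdges G : ℝ) ≤ A * numEdges H := by exact_mod_cast h
      _ ≤ c * numEdges H := by gcongr

theorem sum_coverNumber_le_optSize [Fintype P] (hα : 1 ≤ α) :
    ∑ v ∈ Finset.range n, coverNumber (oracle e) α n v ≤ optSize P α := by
  obtain ⟨H, hH, hopt⟩ := optSize_attained P hα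
  rw [← hopt, numEdges_eq_sum e, Finset.sum_range]
  exact Finset.sum_le_sum fun v _ => coverNumber_le_outDegree e hH v

end

theorem PMF.ofReal_one_sub_le {β : Type*} (p : PMF β) {A B : Set β} {δ : ℝ} (hδ : 0 ≤ δ)
    (hAB : Bᶜ ⊆ A) (h : p.toOuterMeasure B ≤ ENNReal.ofReal δ) :
    ENNReal.ofReal (1 - δ) ≤ p.toOuterMeasure A := by
  have h1 : (1 : ENNReal) ≤ p.toOuterMeasure B + p.toOuterMeasure A := by
    calc (1 : ENNReal) = p.toOuterMeasure Set.univ :=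
          ((p.toOuterMeasure_apply_eq_one_iff _).2 (Set.subset_univ _)).symm
      _ ≤ p.toOuterMeasure (B ∪ A) := by
          refine MeasureTheory.measure_mono fun x _ => ?_
          by_cases hx : x ∈ B
          · exact Or.inl hx
          · exact Or.inr (hAB hx)
      _ ≤ _ := MeasureTheory.measure_union_le _ _
  rw [ENNReal.ofReal_sub _ hδ, ENNReal.ofReal_one, tsub_le_iff_left]
  exact h1.trans (by gcongr)

end SparseNav

theorem theorem5p1 :
    -- one program, one word-length factor `w`, and absolute constants
    ∃ (prog : SparseNav.Cmd) (w k : ℕ) (C₁ C₂ : ℝ),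
      ∀ (n : ℕ) (_ : 2 ≤ n) (P : Type*) [MetricSpace P] [Fintype P] (e : Fin n ≃ P)
        (α : ℝ) (_ : 1 ≤ α),
        ∃ T : ℕ,
          -- the number of steps is `Õ(n * OPT_size)`
          (T : ℝ) ≤ C₁ * ((n : ℝ) * (SparseNav.optSize P α : ℝ)) * Real.log n ^ k ∧
          -- with words of `O(log n)` bits, every run halts within `T` steps
          (∀ c ∈ (SparseNav.run prog (w * Nat.size n) e α T).support, SparseNav.Halted c) ∧
          -- with high probability, the output is an `O(ln n)`-approximation for both objectives
          ENNReal.ofReal (1 - 1 / (n : ℝ)) ≤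
            (SparseNav.run prog (w * Nat.size n) e α T).toOuterMeasure
              {c | SparseNav.IsMaxDegApprox α (C₂ * Real.log n) (SparseNav.outputGraph e c) ∧
                SparseNav.IsSizeApprox α (C₂ * Real.log n) (SparseNav.outputGraph e c)} := by
  -- With `n.size + 1 ≤ 5 * log n`, the constants are `8000000 * 5 ^ 2` and `192 * 5`.
  refine ⟨SparseNav.navCmd, 20, 2, 200000000, 960, fun n hn P _ _ e α hα => ?_⟩
  set K : ℕ → ℕ := SparseNav.coverNumber (SparseNav.oracle e) α n with hK
  have hlog := SparseNav.size_add_one_le_log hn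
  have hKn : ∀ v < n, 1 ≤ K v ∧ K v ≤ n := fun v hv =>
    ⟨SparseNav.coverNumber_pos e hn hα hv, SparseNav.coverNumber_le_card e hα hv⟩
  obtain ⟨hhalt, hprob⟩ := SparseNav.navCmd_within (α := α) (D := SparseNav.oracle e) (K := K)
    (SparseNav.wordBounds_size hn)
    (fun v hv => ⟨(hKn v hv).1, SparseNav.exists_isCover e hα hv⟩)
    (fun v hv t ht htv => SparseNav.covers_oracle_self e hα hv ht htv)
  refine ⟨SparseNav.totalTime n n.size K, ?_, hhalt, ?_⟩
  · have h2 : 1 ≤ n.size := (SparseNav.wordBounds_size hn).pos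
    have h1 : SparseNav.totalTime n n.size K ≤
        8000000 * (n * SparseNav.optSize P α) * (n.size + 1) ^ 2 := by
      refine (SparseNav.totalTime_le (by omega) h2 hKn).trans ?_
      gcongr
      exact SparseNav.sum_coverNumber_le_optSize e hα
    calc (SparseNav.totalTime n n.size K : ℝ)
        ≤ 8000000 * (n * SparseNav.optSize P α) * ((n.size + 1 : ℕ) : ℝ) ^ 2 := by
          exact_mod_cast h1
      _ ≤ 8000000 * (n * SparseNav.optSize P α) * (5 * Real.log n) ^ 2 := by gcongr
      _ = 200000000 * (n * SparseNav.optSize P α) * Real.log n ^ 2 := by ring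
  · refine SparseNav.PMF.ofReal_one_sub_le _ (by positivity) ?_ (hprob.trans
      (ENNReal.ofReal_le_ofReal (SparseNav.sum_sourceError_le hn fun v hv => (hKn v hv).2)))
    intro c hc
    obtain ⟨hs, hcomp⟩ := not_not.1 hc
    refine SparseNav.approx_of_outDegree_le e (A := (n.size + 1) * 192) ?_
      (SparseNav.navigable_outputGraph e hs.lt hcomp) fun v => ?_
    · push_cast at hlog ⊢
      linarith
    · refine (SparseNav.outDegree_outputGraph_le e c v).trans ((hs.count v v.2).trans ?_)
      rw [mul_assoc]
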